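/- Let $D\subset\mathbf C$ be an open disk centered at the origin and let $V$ be a subharmonic function on $D$ (upper semicontinuous, with values in $[-\infty,\infty)$, not identically $-\infty$) such that the support $K$ of its distributional Laplacian $\Delta V$ has Lebesgue measure $0$. Let $\partial V/\partial z=\frac12(\partial V/\partial x-i\,\partial V/\partial y)$ be the distribution derivative. Suppose that $\partial V/\partial z$ is piecewise holomorphic with respect to functions $g_1,\dots,g_k$ holomorphic in $D$, i.e. for every connected component $U$ of $D\setminus K$ there is some $j$ such that $\partial V/\partial z=g_j$ in $U$. For each $\nu$ let $U_\nu$ be the union of those connected components of $D\setminus K$ in which $\partial V/\partial z=g_\nu$. Assume that 1. the origin belongs to the closure of $U_\nu$ for every $1\le\nu\le k$; 2. distinct functions among $g_1,\dots,g_k$ take distinct values at $0$ (if $g_i(0)=g_j(0)$, then $g_i=g_j$ in $D$); 3. each $g_i(0)$ is an extreme point of the convex hull of $\{g_1(0),\dots,g_k(0)\}$. Let $H_1,\dots,H_k$ be the harmonic functions in $D$ determined by $\partial H_\nu/\partial z=g_\nu$ in $D$ and $H_\nu(0)=0$. Then there exists $c\in\mathbf R$ such that $$V=\max(H_1,\dots,H_k)+c$$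 in a neighborhood of the origin. -/

import Mathlib

open scoped Distributions Topology Laplacian

noncomputable section

namespace PiecewiseHarmonic

/-- A subharmonic function on a connected open set `Ω`: it takes values in `[-∞, ∞)`, is upper
semicontinuous, is not identically `-∞`, and satisfies the sub-mean-value inequality
`V a ≤ (1/2π) ∫ V(a + r e^{iθ}) dθ` for every closed disk contained in `Ω`.

On a circle `V` is bounded above, so its mean value in `[-∞, ∞)` is the infimum (the limit as
`M → -∞`) of the mean values of the bounded real functions `max (V, M)`; the inequality is
written in this form. -/
structure IsSubharmonic (Ω : TopologicalSpace.Opens ℂ) (V : ℂ → EReal) : Prop where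
  lt_top : ∀ z ∈ Ω, V z < ⊤
  upperSemicontinuousOn : UpperSemicontinuousOn V Ω
  exists_ne_bot : ∃ z ∈ Ω, V z ≠ ⊥
  le_circleAverage : ∀ (a : ℂ) (r : ℝ), 0 < r → Metric.closedBall a r ⊆ Ω → ∀ M : ℝ,
    V a ≤ ((Real.circleAverage (fun z => (max (V z) (M : EReal)).toReal) a r : ℝ) : EReal)

/-- The distributional Laplacian of `V` on `Ω`, as a functional on test functions. (A subharmonic
function is locally integrable and is `-∞` only on a null set.) -/
def distLaplacian (Ω : TopologicalSpace.Opens ℂ) (V : ℂ → EReal) (φ : 𝓓(Ω, ℝ)) : ℝ :=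
  ∫ z : ℂ, (V z).toReal * Δ (φ : ℂ → ℝ) z

/-- The support in `Ω` of the distributional Laplacian of `V`. -/
def suppLaplacian (Ω : TopologicalSpace.Opens ℂ) (V : ℂ → EReal) : Set ℂ :=
  (Ω : Set ℂ) ∩ Distribution.dsupport (distLaplacian Ω V)

/-- The class `SH₀(Ω)` of subharmonic functions on `Ω` whose Laplacian has a support of
Lebesgue measure zero. -/
structure IsSH₀ (Ω : TopologicalSpace.Opens ℂ) (V : ℂ → EReal) : Prop where
  isSubharmonic : IsSubharmonic Ω V
  volume_suppLaplacian : MeasureTheory.volume (suppLaplacian Ω V) = 0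

/-- The derivative `∂f/∂z = (∂f/∂x - i ∂f/∂y) / 2` of a real function of `z = x + i y`. -/
def dz (f : ℂ → ℝ) (z : ℂ) : ℂ :=
  (1 / 2) * ((fderiv ℝ f z 1 : ℝ) - Complex.I * (fderiv ℝ f z Complex.I : ℝ))

/-- The distribution derivative `∂V/∂z` is equal to the function `g` in the open subset `U`
of `Ω`. -/
def DzEqOn (Ω : TopologicalSpace.Opens ℂ) (V : ℂ → EReal) (U : Set ℂ) (g : ℂ → ℂ) : Prop :=
  ∀ φ : 𝓓(Ω, ℝ), tsupport φ ⊆ U →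
    -∫ z : ℂ, ((V z).toReal : ℂ) * dz φ z = ∫ z : ℂ, g z * (φ z : ℂ)

/-- The connected component of `z` in `Ω \ supp ΔV`. -/
def component (Ω : TopologicalSpace.Opens ℂ) (V : ℂ → EReal) (z : ℂ) : Set ℂ :=
  connectedComponentIn ((Ω : Set ℂ) \ suppLaplacian Ω V) z

/-- `∂V/∂z` is piecewise holomorphic in `Ω` with respect to `g₁, …, g_k`: these functions are
holomorphic in `Ω`, and in each connected component of `Ω \ supp ΔV` one of them equals
`∂V/∂z`. -/
structure IsPiecewiseHolomorphic (Ω : TopologicalSpace.Opens ℂ) (V : ℂ → EReal) {k : ℕ}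
    (g : Fin k → ℂ → ℂ) : Prop where
  holomorphic : ∀ i, DifferentiableOn ℂ (g i) Ω
  exists_dzEqOn : ∀ z ∈ (Ω : Set ℂ) \ suppLaplacian Ω V, ∃ i,
    DzEqOn Ω V (component Ω V z) (g i)

/-- The union of those connected components of `Ω \ supp ΔV` in which `∂V/∂z = g`. -/
def region (Ω : TopologicalSpace.Opens ℂ) (V : ℂ → EReal) (g : ℂ → ℂ) : Set ℂ :=
  {z ∈ (Ω : Set ℂ) \ suppLaplacian Ω V | DzEqOn Ω V (component Ω V z) g}

/-- The open disk of radius `R` centered at the origin. -/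
def disk (R : ℝ) : TopologicalSpace.Opens ℂ := ⟨Metric.ball 0 R, Metric.isOpen_ball⟩

end PiecewiseHarmonic

end

namespace PiecewiseHarmonic

open MeasureTheory Metric Set Filter InnerProductSpace
open scoped ContDiff Convolution

/-! Fix `j`. Since `g j 0` is an extreme point of the hull of finitely many values, it is strictly
exposed: some direction `θ` makes `Re (g i 0 * θ)` largest exactly for those `i` with `g i 0 = g j
0`, for which `g i = g j`. By continuity and homogeneity `Re (g i z * w) ≤ Re (g j z * w)` for `z`
near `0`, for all `w` in an open convex cone around `θ` and all `i`. Off the support `K` of the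
Laplacian, `V` is locally some `H i + const`, so along any segment in a cone direction that misses
`K` the function `V - H j` does not increase.

The main difficulty is to cross `K`, which is only known to be closed and null. A truncation `F` of
`V - H j` from below is bounded and has the sub-mean-value property, so its discrete Dirichlet
energy at step `t` is `O(t²)` (`exists_energy_le`, a Caccioppoli estimate). Steps of length below
`t` can increase `F` only from points of the `t`-neighbourhood of `K`, whose measure (locally) tends
to `0`. The inequality `x ≤ x² / (λt) + λt` then makes the total increase over `n ~ 1/t` steps at
most `O(1/λ) + λ o(1)`; letting `t → 0` and then `λ → ∞` gives monotonicity almost everywhere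
(`IsBoundedSubMean.ae_add_le`). Semicontinuity and the sub-mean-value property upgrade it to every
point (`IsBoundedSubMean.add_le`).

If `∂V/∂z = g j` near `z`, then `V - H j` equals a constant near `z` and is at most this constant on
the cone with vertex `z`; by the strong maximum principle it is equal to it there. All cones with
vertex close to `0` contain a common point `p`. Hence the constant `c j` is the same at all such
`z`, and monotonicity from an arbitrary `z` to `p` gives `V ≥ H j + c j` near `0`
(`IsSubharmonic.exists_local_bound`). Almost every point lies in some region, so `V = max (H j + c
j)` almost everywhere, hence everywhere near `0`. Each region accumulates at `0`, where `H j = 0`,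
so every `c j` is the value of this maximum at `0`. -/

/-- The sub-mean-value inequality over the closed disks contained in `Ω`. -/
def SubMean (Ω : Set ℂ) (F : ℂ → ℝ) : Prop :=
  ∀ (a : ℂ) (s : ℝ), 0 < s → closedBall a s ⊆ Ω →
    Real.pi * F a ≤ ∫ v in ball (0 : ℂ) 1, F (a + s • v)

/-! ### Area means and integrability on the unit disk -/

lemma volume_real_unit_ball : (volume : Measure ℂ).real (ball 0 1) = Real.pi := by
  simp [Measure.real, Complex.volume_ball]

lemma circleIntegrable_of_bounded {F : ℂ → ℝ} (hF : Measurable F) {L : ℝ} {a : ℂ} {s : ℝ}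
    (hL : ∀ z ∈ sphere a |s|, |F z| ≤ L) : CircleIntegrable F a s := by
  unfold CircleIntegrable
  rw [intervalIntegrable_iff]
  refine Measure.integrableOn_of_bounded (M := L) (by simp [uIoc, Real.volume_Ioc]) ?_ ?_
  · exact (hF.comp (continuous_circleMap a s).measurable).aestronglyMeasurable
  · exact Eventually.of_forall fun θ => hL _ (circleMap_mem_sphere' a s θ)

/-- Integration of the circle means against `ρ dρ` in polar coordinates. Area means suit the later
arguments better, because they see sets of positive measure and allow Fubini in the displacement. -/
lemma le_integral_ball_of_le_circleAverage {F : ℂ → ℝ} (hF : Measurable F) {L m : ℝ} {a : ℂ}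
    {s : ℝ} (hs : 0 < s) (hL : ∀ z ∈ closedBall a s, |F z| ≤ L)
    (h : ∀ ρ, 0 < ρ → ρ < s → m ≤ Real.circleAverage F a ρ) :
    Real.pi * m ≤ ∫ v in ball (0 : ℂ) 1, F (a + s • v) := by
  have hmeas : Measurable fun p : ℝ × ℝ =>
      p.1 * F (a + s • Complex.polarCoord.symm p) := by
    have : Measurable fun p : ℝ × ℝ => Complex.polarCoord.symm p := by
      have : (fun p : ℝ × ℝ => Complex.polarCoord.symm p) =
        fun p => (p.1 : ℂ) * (Real.cos p.2 + Real.sin p.2 * Complex.I) := by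
        ext p; simp
      rw [this]; fun_prop
    fun_prop
  have hmem : ∀ p : ℝ × ℝ, p ∈ Ioo (0 : ℝ) 1 ×ˢ Ioo (-Real.pi) Real.pi →
      a + s • Complex.polarCoord.symm p ∈ closedBall a s := by
    rintro p ⟨hp, -⟩
    rw [mem_closedBall, dist_eq_norm, add_sub_cancel_left, norm_smul, Complex.norm_polarCoord_symm,
      abs_of_pos hp.1, Real.norm_of_nonneg hs.le]
    nlinarith [hp.2]
  have hint : IntegrableOn (fun p : ℝ × ℝ => p.1 * F (a + s • Complex.polarCoord.symm p))
      (Ioo (0 : ℝ) 1 ×ˢ Ioo (-Real.pi) Real.pi) (volume.prod volume) := by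
    refine Measure.integrableOn_of_bounded (M := L) ?_ hmeas.aestronglyMeasurable ?_
    · rw [Measure.prod_prod]; simp
    · refine (ae_restrict_iff' (measurableSet_Ioo.prod measurableSet_Ioo)).2
        (Eventually.of_forall fun p hp => ?_)
      rw [norm_mul, Real.norm_eq_abs, Real.norm_eq_abs, abs_of_pos hp.1.1]
      have h1 := hL _ (hmem p hp)
      nlinarith [hp.1.2, hp.1.1, abs_nonneg (F (a + s • Complex.polarCoord.symm p))]
  have hinner : ∀ ρ ∈ Ioo (0 : ℝ) 1, ∫ θ in Ioo (-Real.pi) Real.pi,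
      ρ * F (a + s • Complex.polarCoord.symm (ρ, θ)) =
        ρ * (2 * Real.pi * Real.circleAverage F a (s * ρ)) := by
    intro ρ hρ
    rw [integral_const_mul]
    congr 1
    rw [Real.circleAverage_eq_integral_add (-Real.pi)]
    have hpi := Real.pi_pos
    rw [smul_eq_mul, mul_inv_cancel_left₀ (by positivity),
      intervalIntegral.integral_comp_add_right (fun θ => F (circleMap a (s * ρ) θ)),
      intervalIntegral.integral_of_le (by linarith), ← integral_Ioc_eq_integral_Ioo]
    rw [show 0 + -Real.pi = -Real.pi by ring, show 2 * Real.pi + -Real.pi = Real.pi by ring]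
    refine setIntegral_congr_fun measurableSet_Ioc fun θ _ => ?_
    simp only [circleMap, Complex.polarCoord_symm_apply, Complex.real_smul, Complex.exp_mul_I]
    push_cast
    ring_nf
  have key : ∫ v in ball (0 : ℂ) 1, F (a + s • v) =
      ∫ ρ in Ioo (0 : ℝ) 1, ρ * (2 * Real.pi * Real.circleAverage F a (s * ρ)) := by
    rw [← integral_indicator measurableSet_ball, ← Complex.integral_comp_polarCoord_symm]
    have : ∫ p in polarCoord.target, p.1 • (ball (0 : ℂ) 1).indicator (fun v => F (a + s • v))
          (Complex.polarCoord.symm p) =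
        ∫ p in Ioo (0 : ℝ) 1 ×ˢ Ioo (-Real.pi) Real.pi,
          p.1 * F (a + s • Complex.polarCoord.symm p) := by
      rw [← integral_indicator polarCoord.open_target.measurableSet,
        ← integral_indicator (measurableSet_Ioo.prod measurableSet_Ioo)]
      congr 1
      ext p
      by_cases hp : p ∈ Ioo (0 : ℝ) 1 ×ˢ Ioo (-Real.pi) Real.pi
      · have hp' : p ∈ polarCoord.target := ⟨hp.1.1, hp.2⟩
        have hb : Complex.polarCoord.symm p ∈ ball (0 : ℂ) 1 := by
          rw [mem_ball_zero_iff, Complex.norm_polarCoord_symm, abs_of_pos hp.1.1]; exact hp.1.2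
        rw [indicator_of_mem hp, indicator_of_mem hp', indicator_of_mem hb, smul_eq_mul]
      · rw [indicator_of_notMem hp]
        by_cases hp' : p ∈ polarCoord.target
        · have hb : Complex.polarCoord.symm p ∉ ball (0 : ℂ) 1 := by
            rw [mem_ball_zero_iff, Complex.norm_polarCoord_symm, abs_of_pos hp'.1]
            exact fun h' => hp ⟨⟨hp'.1, h'⟩, hp'.2⟩
          rw [indicator_of_mem hp', indicator_of_notMem hb, smul_zero]
        · rw [indicator_of_notMem hp']
    rw [this, Measure.volume_eq_prod, setIntegral_prod _ hint]
    exact setIntegral_congr_fun measurableSet_Ioo hinner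
  rw [key]
  have h1 : ∫ ρ in Ioo (0 : ℝ) 1, ρ * (2 * Real.pi * m) = Real.pi * m := by
    rw [integral_mul_const, ← integral_Ioc_eq_integral_Ioo,
      ← intervalIntegral.integral_of_le zero_le_one, integral_id]
    ring
  rw [← h1]
  refine setIntegral_mono_on ?_ ?_ measurableSet_Ioo ?_
  · exact (Continuous.integrableOn_Icc (by fun_prop)).mono_set Ioo_subset_Icc_self
  · rw [IntegrableOn, ← Measure.prod_restrict] at hint
    exact IntegrableOn.congr_fun hint.integral_prod_left hinner measurableSet_Ioo
  · intro ρ hρ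
    have := h (s * ρ) (mul_pos hs hρ.1) (by nlinarith [hρ.2])
    have hpi := Real.pi_pos
    exact mul_le_mul_of_nonneg_left (mul_le_mul_of_nonneg_left this (by positivity)) hρ.1.le

lemma integrable_prod_of_bounded {g : ℂ × ℂ → ℝ} (hg : Measurable g) {r c : ℝ}
    (hc : ∀ p, p.2 ∈ ball (0 : ℂ) 1 → |g p| ≤ c) (h0 : ∀ p, p.1 ∉ ball (0 : ℂ) r → g p = 0) :
    Integrable g (volume.prod (volume.restrict (ball (0 : ℂ) 1))) := by
  have h1 : IntegrableOn g (ball (0 : ℂ) r ×ˢ ball (0 : ℂ) 1) (volume.prod volume) := by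
    refine Measure.integrableOn_of_bounded (M := c) ?_ hg.aestronglyMeasurable ?_
    · rw [Measure.prod_prod]
      exact ENNReal.mul_ne_top measure_ball_lt_top.ne measure_ball_lt_top.ne
    · exact (ae_restrict_iff' (measurableSet_ball.prod measurableSet_ball)).2
        (Eventually.of_forall fun p hp => hc p hp.2)
  rw [IntegrableOn, ← Measure.prod_restrict] at h1
  have h2 : IntegrableOn g (ball (0 : ℂ) r ×ˢ univ)
      (volume.prod (volume.restrict (ball (0 : ℂ) 1))) := by
    rwa [IntegrableOn, ← Measure.prod_restrict, Measure.restrict_univ]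
  rw [← integrableOn_iff_integrable_of_support_subset (s := ball (0 : ℂ) r ×ˢ univ)]
  · exact h2
  · intro p hp
    refine ⟨?_, mem_univ _⟩
    by_contra h
    exact hp (h0 p h)

lemma integrableOn_ball_const (a : ℂ) (r c : ℝ) : IntegrableOn (fun _ : ℂ => c) (ball a r) :=
  integrableOn_const measure_ball_lt_top.ne

lemma integrableOn_ball_of_continuous {f : ℂ → ℝ} (hf : Continuous f) (a : ℂ) (r : ℝ) :
    IntegrableOn f (ball a r) :=
  (hf.continuousOn.integrableOn_compact (isCompact_closedBall a r)).mono_set ball_subset_closedBall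

lemma integral_ball_inner_eq_zero (z : ℂ) :
    ∫ v in ball (0 : ℂ) 1, inner ℝ z v = 0 := by
  have h : ∫ v in ball (0 : ℂ) 1, inner ℝ z v = ∫ v in ball (0 : ℂ) 1, inner ℝ z (-v) := by
    rw [← integral_indicator measurableSet_ball, ← integral_indicator measurableSet_ball,
      ← integral_neg_eq_self]
    congr 1
    ext v
    simp [indicator]
  simp only [inner_neg_right, integral_neg] at h
  linarith

/-! ### The discrete Caccioppoli estimate -/

/-- A nonnegative `C^{1,1}` cutoff function supported in the disk of radius `ρ`. -/
noncomputable def cutoff (ρ : ℝ) (z : ℂ) : ℝ := (max 0 (ρ ^ 2 - ‖z‖ ^ 2)) ^ 2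

lemma continuous_cutoff (ρ : ℝ) : Continuous (cutoff ρ) := by
  unfold cutoff; fun_prop

lemma cutoff_nonneg (ρ : ℝ) (z : ℂ) : 0 ≤ cutoff ρ z := sq_nonneg _

lemma cutoff_eq_zero {ρ : ℝ} (hρ : 0 ≤ ρ) {z : ℂ} (hz : ρ ≤ ‖z‖) : cutoff ρ z = 0 := by
  unfold cutoff
  rw [max_eq_left (by nlinarith)]; norm_num

lemma cutoff_le {ρ : ℝ} (z : ℂ) : cutoff ρ z ≤ (ρ ^ 2) ^ 2 := by
  unfold cutoff
  refine pow_le_pow_left₀ (le_max_left _ _) (max_le (by positivity) ?_) 2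
  nlinarith [sq_nonneg ‖z‖]

/-- Second-order Taylor bound: the term linear in `v` is odd and integrates to `0` over the disk,
which leaves an error quadratic in `t`. Only this upper bound is needed. -/
lemma integral_cutoff_sub_le {ρ r t : ℝ} {z : ℂ} (ht : 0 < t) (htr : t ≤ r)
    (hz : ‖z‖ ≤ r) :
    ∫ v in ball (0 : ℂ) 1, (cutoff ρ (z - t • v) - cutoff ρ z) ≤ Real.pi * (9 * r ^ 2 * t ^ 2) := by
  have hpt : ∀ v ∈ ball (0 : ℂ) 1, cutoff ρ (z - t • v) - cutoff ρ z ≤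
      (4 * t * max 0 (ρ ^ 2 - ‖z‖ ^ 2)) * inner ℝ z v + 9 * r ^ 2 * t ^ 2 := by
    intro v hv
    have hv1 : ‖v‖ < 1 := mem_ball_zero_iff.1 hv
    have hn : ‖z - t • v‖ ^ 2 = ‖z‖ ^ 2 - 2 * t * inner ℝ z v + t ^ 2 * ‖v‖ ^ 2 := by
      rw [norm_sub_sq_real, inner_smul_right, norm_smul, Real.norm_of_nonneg ht.le]; ring
    have hin : |inner ℝ z v| ≤ r := (abs_real_inner_le_norm z v).trans (by
      nlinarith [norm_nonneg z, norm_nonneg v])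
    have hin' := abs_le.1 hin
    have hr : 0 < r := ht.trans_le htr
    unfold cutoff
    rw [hn]
    set p := ρ ^ 2 - ‖z‖ ^ 2
    set x : ℝ := inner ℝ z v
    set d := 2 * t * x - t ^ 2 * ‖v‖ ^ 2 with hd
    have e : ρ ^ 2 - (‖z‖ ^ 2 - 2 * t * x + t ^ 2 * ‖v‖ ^ 2) = p + d := by ring
    rw [e]
    -- Taylor's inequality for `x ↦ (max 0 x) ^ 2`, whose derivative is `2`-Lipschitz.
    have hmain : (max 0 (p + d)) ^ 2 ≤ (max 0 p) ^ 2 + 2 * max 0 p * d + d ^ 2 := by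
      rcases le_total p 0 with h | h <;> rcases le_total (p + d) 0 with h' | h' <;>
      simp only [max_eq_left, max_eq_right, h, h'] <;> nlinarith
    have hv2 : ‖v‖ ^ 2 ≤ 1 := by nlinarith [norm_nonneg v]
    have hd2 : d ^ 2 ≤ 9 * r ^ 2 * t ^ 2 := by
      have h1 : |d| ≤ 3 * r * t := by
        rw [abs_le]
        have : 0 ≤ t ^ 2 * ‖v‖ ^ 2 := by positivity
        have : t ^ 2 * ‖v‖ ^ 2 ≤ t * r := by nlinarith
        constructor <;> nlinarith
      calc d ^ 2 = |d| ^ 2 := (sq_abs d).symm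
        _ ≤ (3 * r * t) ^ 2 := pow_le_pow_left₀ (abs_nonneg _) h1 2
        _ = _ := by ring
    have hd1 : d ≤ 2 * t * x := by
      have : 0 ≤ t ^ 2 * ‖v‖ ^ 2 := by positivity
      linarith
    have := mul_le_mul_of_nonneg_left hd1 (le_max_left 0 p)
    nlinarith
  have hi : IntegrableOn (fun v : ℂ => (4 * t * max 0 (ρ ^ 2 - ‖z‖ ^ 2)) * inner ℝ z v)
      (ball 0 1) :=
    integrableOn_ball_of_continuous (by fun_prop) _ _
  calc _ ≤ ∫ v in ball (0 : ℂ) 1,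
        ((4 * t * max 0 (ρ ^ 2 - ‖z‖ ^ 2)) * inner ℝ z v + 9 * r ^ 2 * t ^ 2) := by
        have := continuous_cutoff ρ
        exact setIntegral_mono_on (integrableOn_ball_of_continuous (by fun_prop) _ _)
          (hi.add (integrableOn_ball_const _ _ _)) measurableSet_ball hpt
    _ = _ := by
        rw [integral_add hi (integrableOn_ball_const _ _ _), integral_const_mul,
          integral_ball_inner_eq_zero]
        simp [volume_real_unit_ball]

/-- The discrete Dirichlet energy of a bounded function satisfying the sub-mean-value inequality
is of the order of the square of the step. -/
lemma exists_energy_le {r L : ℝ} (hr : 0 < r) {F : ℂ → ℝ} (hF : Measurable F) (hF0 : ∀ z, 0 ≤ F z)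
    (hFL : ∀ z, F z ≤ L) (hsub : SubMean (ball 0 r) F) :
    ∃ C : ℝ, 0 ≤ C ∧ ∀ t, 0 < t → t ≤ r / 8 →
      ∫⁻ v in ball (0 : ℂ) 1, ∫⁻ z in ball (0 : ℂ) (r / 2),
        ENNReal.ofReal ((F (z + t • v) - F z) ^ 2) ≤ ENNReal.ofReal (C * t ^ 2) := by
  have hL : 0 ≤ L := (hF0 0).trans (hFL 0)
  set ρ := 3 * r / 4 with hρ
  have hρ0 : 0 < ρ := by positivity
  set χ := cutoff ρ with hχ
  have hχm : Measurable χ := (continuous_cutoff ρ).measurable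
  -- A lower bound of the cutoff on the disk of radius `r / 2`: `(3/4)² - (1/2)² = 5/16`.
  set κ : ℝ := (5 * r ^ 2 / 16) ^ 2 with hκ
  have hκ0 : 0 < κ := by positivity
  set X : ℝ := (ρ ^ 2) ^ 2 with hX
  have hX0 : 0 ≤ X := by positivity
  have hvol : 0 ≤ (volume : Measure ℂ).real (ball 0 r) := measureReal_nonneg
  refine ⟨κ⁻¹ * ((volume : Measure ℂ).real (ball 0 r) * (L ^ 2 * (Real.pi * (9 * r ^ 2)))),
    by positivity, fun t ht htr => ?_⟩
  set μ : Measure ℂ := volume.restrict (ball (0 : ℂ) 1) with hμ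
  have hsq : ∀ z, (F z) ^ 2 ≤ L ^ 2 := fun z => pow_le_pow_left₀ (hF0 z) (hFL z) 2
  have hχ0 : ∀ z, z ∉ ball (0 : ℂ) r → χ z = 0 := fun z hz => by
    refine cutoff_eq_zero hρ0.le ?_
    rw [mem_ball_zero_iff, not_lt] at hz; linarith
  have hχ0' : ∀ z, z ∉ ball (0 : ℂ) r → ∀ v ∈ ball (0 : ℂ) 1, χ (z - t • v) = 0 := by
    intro z hz v hv
    refine cutoff_eq_zero hρ0.le ?_
    rw [mem_ball_zero_iff, not_lt] at hz
    rw [mem_ball_zero_iff] at hv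
    have := norm_sub_norm_le z (t • v)
    rw [norm_smul, Real.norm_of_nonneg ht.le] at this
    nlinarith [norm_nonneg v]
  have hdiff : ∀ z v, (F (z + t • v) - F z) ^ 2 ≤ L ^ 2 := fun z v => by
    rw [← sq_abs]
    refine pow_le_pow_left₀ (abs_nonneg _) (abs_le.2 ⟨?_, ?_⟩) 2 <;>
    linarith [hF0 z, hFL z, hF0 (z + t • v), hFL (z + t • v)]
  -- integrability of the three integrands
  have i1 : Integrable (fun p : ℂ × ℂ => χ p.1 * (F (p.1 + t • p.2) - F p.1) ^ 2)
      (volume.prod μ) := by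
    refine integrable_prod_of_bounded (by fun_prop) (r := r) (c := X * L ^ 2) ?_ ?_
    · intro p _
      rw [abs_of_nonneg (mul_nonneg (cutoff_nonneg _ _) (sq_nonneg _))]
      exact mul_le_mul (cutoff_le _) (hdiff _ _) (sq_nonneg _) hX0
    · intro p hp; simp [hχ0 _ hp]
  have i2 : Integrable (fun p : ℂ × ℂ => χ p.1 * (F (p.1 + t • p.2)) ^ 2) (volume.prod μ) := by
    refine integrable_prod_of_bounded (by fun_prop) (r := r) (c := X * L ^ 2) ?_ ?_
    · intro p _
      rw [abs_of_nonneg (mul_nonneg (cutoff_nonneg _ _) (sq_nonneg _))]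
      exact mul_le_mul (cutoff_le _) (hsq _) (sq_nonneg _) hX0
    · intro p hp; simp [hχ0 _ hp]
  have i3 : Integrable (fun p : ℂ × ℂ => χ p.1 * (F p.1) ^ 2) (volume.prod μ) := by
    refine integrable_prod_of_bounded (by fun_prop) (r := r) (c := X * L ^ 2) ?_ ?_
    · intro p _
      rw [abs_of_nonneg (mul_nonneg (cutoff_nonneg _ _) (sq_nonneg _))]
      exact mul_le_mul (cutoff_le _) (hsq _) (sq_nonneg _) hX0
    · intro p hp; simp [hχ0 _ hp]
  have i4 : Integrable (fun p : ℂ × ℂ => (χ (p.1 - t • p.2) - χ p.1) * (F p.1) ^ 2)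
      (volume.prod μ) := by
    have : Integrable ((univ ×ˢ ball (0 : ℂ) 1).indicator fun p : ℂ × ℂ =>
        (χ (p.1 - t • p.2) - χ p.1) * (F p.1) ^ 2) (volume.prod μ) := by
      refine integrable_prod_of_bounded ?_ (r := r) (c := X * L ^ 2) ?_ ?_
      · exact Measurable.indicator (by fun_prop) (MeasurableSet.univ.prod measurableSet_ball)
      · intro p hp
        rw [indicator_of_mem (show p ∈ univ ×ˢ ball (0 : ℂ) 1 from ⟨mem_univ _, hp⟩), abs_mul,
          abs_of_nonneg (sq_nonneg (F p.1))]
        refine mul_le_mul (abs_le.2 ⟨?_, ?_⟩) (hsq _) (sq_nonneg _) hX0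
        · linarith [cutoff_nonneg ρ (p.1 - t • p.2), cutoff_le (ρ := ρ) p.1]
        · linarith [cutoff_nonneg ρ p.1, cutoff_le (ρ := ρ) (p.1 - t • p.2)]
      · intro p hp
        by_cases h : p ∈ (univ : Set ℂ) ×ˢ ball (0 : ℂ) 1
        · rw [indicator_of_mem h, hχ0 _ hp, hχ0' _ hp _ h.2]; ring
        · rw [indicator_of_notMem h]
    refine this.congr ?_
    have hm : MeasurableSet ((univ : Set ℂ) ×ˢ ball (0 : ℂ) 1) :=
      MeasurableSet.univ.prod measurableSet_ball
    have : (volume.prod μ : Measure (ℂ × ℂ)) =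
        (volume.prod volume).restrict (univ ×ˢ ball (0 : ℂ) 1) := by
      rw [hμ, ← Measure.prod_restrict, Measure.restrict_univ]
    rw [this]
    exact indicator_ae_eq_restrict hm
  have hmain : ∫ p, χ p.1 * (F (p.1 + t • p.2) - F p.1) ^ 2 ∂(volume.prod μ) ≤
      (volume : Measure ℂ).real (ball 0 r) * (L ^ 2 * (Real.pi * (9 * r ^ 2 * t ^ 2))) := by
    -- Discrete form of `2 |∇F|² ≤ Δ(F²)`: in the expanded square the cross term is `-2 F(z) F(z +
    -- tv)`, and its mean over `v` is at most `-2 F(z)²` by the sub-mean-value inequality and `F ≥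
    -- 0`.
    calc _ ≤ ∫ p, (χ p.1 * (F (p.1 + t • p.2)) ^ 2 - χ p.1 * (F p.1) ^ 2) ∂(volume.prod μ) := by
          rw [integral_prod _ i1, integral_prod (fun p : ℂ × ℂ =>
            χ p.1 * (F (p.1 + t • p.2)) ^ 2 - χ p.1 * (F p.1) ^ 2) (i2.sub i3)]
          refine integral_mono_ae i1.integral_prod_left (i2.sub i3).integral_prod_left ?_
          refine Eventually.of_forall fun z => ?_
          by_cases hz : ‖z‖ < ρ
          · have hb : Integrable (fun v : ℂ => F (z + t • v)) μ := by
              refine Measure.integrableOn_of_bounded (M := L) measure_ball_lt_top.ne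
                (Measurable.aestronglyMeasurable (by fun_prop)) (Eventually.of_forall fun v => ?_)
              rw [Real.norm_of_nonneg (hF0 _)]; exact hFL _
            have hb2 : Integrable (fun v : ℂ => (F (z + t • v)) ^ 2) μ := by
              refine Measure.integrableOn_of_bounded (M := L ^ 2) measure_ball_lt_top.ne
                (Measurable.aestronglyMeasurable (by fun_prop)) (Eventually.of_forall fun v => ?_)
              rw [Real.norm_of_nonneg (sq_nonneg _)]; exact hsq _
            have hc : ∀ c : ℝ, Integrable (fun _ : ℂ => c) μ := integrableOn_ball_const _ _
            have hcs : ∀ c : ℝ, ∫ _ : ℂ, c ∂μ = Real.pi * c := fun c => by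
              simp [μ, volume_real_unit_ball]
            have hs := hsub z t ht (fun w hw => by
              rw [mem_ball_zero_iff]
              have := mem_closedBall_iff_norm.1 hw
              have := norm_le_norm_add_norm_sub z w
              rw [norm_sub_rev] at this
              linarith)
            have e1 : ∀ v, χ z * (F (z + t • v) - F z) ^ 2 =
                χ z * ((F (z + t • v)) ^ 2 + ((F z) ^ 2 - (2 * F z) * F (z + t • v))) :=
              fun v => by ring
            have e2 : ∀ v, χ z * (F (z + t • v)) ^ 2 - χ z * (F z) ^ 2 =
              χ z * ((F (z + t • v)) ^ 2 - (F z) ^ 2) := fun v => by ring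
            have hb3 : Integrable (fun v : ℂ => (F z) ^ 2 - (2 * F z) * F (z + t • v)) μ :=
              (hc _).sub (hb.const_mul _)
            simp only [e1, e2]
            rw [integral_const_mul, integral_const_mul, integral_add hb2 hb3,
              integral_sub (hc _) (hb.const_mul _), integral_const_mul,
              integral_sub hb2 (hc _), hcs]
            refine mul_le_mul_of_nonneg_left ?_ (cutoff_nonneg _ _)
            have := mul_le_mul_of_nonneg_left hs (hF0 z)
            linarith
          · have : χ z = 0 := cutoff_eq_zero hρ0.le (not_lt.1 hz)
            simp [this]
      -- Discrete integration by parts: translation by `t • v` moves the difference from `F²` to the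
      -- cutoff.
      _ = ∫ p, (χ (p.1 - t • p.2) - χ p.1) * (F p.1) ^ 2 ∂(volume.prod μ) := by
          have i5 : Integrable (fun p : ℂ × ℂ => χ (p.1 - t • p.2) * (F p.1) ^ 2)
              (volume.prod μ) := by
            refine (i4.add i3).congr (Eventually.of_forall fun p => ?_)
            simp only [Pi.add_apply]; ring
          have e : ∀ p : ℂ × ℂ, (χ (p.1 - t • p.2) - χ p.1) * (F p.1) ^ 2 =
            χ (p.1 - t • p.2) * (F p.1) ^ 2 - χ p.1 * (F p.1) ^ 2 := fun p => by ring
          simp only [e]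
          rw [integral_sub i2 i3, integral_sub i5 i3, integral_prod_symm _ i2,
            integral_prod_symm _ i5]
          congr 2
          ext v
          simp only
          rw [← integral_sub_right_eq_self _ (t • v)]
          simp
      _ ≤ ∫ z, (ball (0 : ℂ) r).indicator (fun _ => L ^ 2 * (Real.pi * (9 * r ^ 2 * t ^ 2))) z := by
          rw [integral_prod _ i4]
          refine integral_mono i4.integral_prod_left ((integrable_indicator_iff
            measurableSet_ball).2 (integrableOn_ball_const _ _ _)) ?_
          intro z
          simp only
          by_cases hz : z ∈ ball (0 : ℂ) r
          · rw [indicator_of_mem hz, integral_mul_const, mul_comm]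
            have h1 := integral_cutoff_sub_le (ρ := ρ) ht (by linarith)
              (mem_ball_zero_iff.1 hz).le
            calc _ ≤ (F z) ^ 2 * (Real.pi * (9 * r ^ 2 * t ^ 2)) :=
                  mul_le_mul_of_nonneg_left h1 (sq_nonneg _)
              _ ≤ _ := mul_le_mul_of_nonneg_right (hsq z)
                  (mul_nonneg Real.pi_pos.le (by positivity))
          · rw [indicator_of_notMem hz]
            refine le_of_eq (setIntegral_eq_zero_of_forall_eq_zero fun v hv => ?_)
            simp only [hχ0 _ hz, hχ0' _ hz _ hv]; ring
      _ = _ := by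
          rw [integral_indicator measurableSet_ball]; simp
  have hpos : ∀ p : ℂ × ℂ, 0 ≤ χ p.1 * (F (p.1 + t • p.2) - F p.1) ^ 2 := fun p =>
    mul_nonneg (cutoff_nonneg _ _) (sq_nonneg _)
  rw [lintegral_lintegral_swap (f := fun v z => ENNReal.ofReal ((F (z + t • v) - F z) ^ 2))
    (Measurable.aemeasurable (by unfold Function.uncurry; fun_prop))]
  calc _ ≤ ∫⁻ z in ball (0 : ℂ) (r / 2), ∫⁻ v, ENNReal.ofReal κ⁻¹ *
        ENNReal.ofReal (χ z * (F (z + t • v) - F z) ^ 2) ∂μ := by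
        refine setLIntegral_mono' measurableSet_ball fun z hz => lintegral_mono fun v => ?_
        rw [← ENNReal.ofReal_mul (by positivity)]
        refine ENNReal.ofReal_le_ofReal ?_
        have h1 : κ ≤ χ z := by
          refine pow_le_pow_left₀ (by positivity) (le_max_of_le_right ?_) 2
          have := mem_ball_zero_iff.1 hz
          rw [hρ]
          nlinarith [norm_nonneg z]
        rw [← mul_assoc]
        refine le_mul_of_one_le_left (sq_nonneg _) ?_
        rw [inv_mul_eq_div, one_le_div hκ0]; exact h1
    _ ≤ ∫⁻ z, ∫⁻ v, ENNReal.ofReal κ⁻¹ *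
        ENNReal.ofReal (χ z * (F (z + t • v) - F z) ^ 2) ∂μ := setLIntegral_le_lintegral _ _
    _ = ENNReal.ofReal κ⁻¹ * ∫⁻ p, ENNReal.ofReal
          (χ p.1 * (F (p.1 + t • p.2) - F p.1) ^ 2) ∂(volume.prod μ) := by
        rw [lintegral_prod _ (Measurable.aemeasurable (by fun_prop)),
          ← lintegral_const_mul _ (Measurable.lintegral_prod_right' (f := fun p : ℂ × ℂ =>
            ENNReal.ofReal (χ p.1 * (F (p.1 + t • p.2) - F p.1) ^ 2)) (by fun_prop))]
        congr 1
        ext z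
        rw [lintegral_const_mul _ (by fun_prop)]
    _ ≤ _ := by
        rw [← ofReal_integral_eq_lintegral_ofReal i1 (Eventually.of_forall hpos),
          ← ENNReal.ofReal_mul (by positivity)]
        refine ENNReal.ofReal_le_ofReal ?_
        calc _ ≤ κ⁻¹ * _ := mul_le_mul_of_nonneg_left hmain (by positivity)
          _ = _ := by ring

/-! ### Monotonicity across closed null sets -/

/-- A nonnegative bounded function on the plane which is subharmonic in `Ω`. -/
structure IsBoundedSubMean (Ω : Set ℂ) (F : ℂ → ℝ) : Prop where
  measurable : Measurable F
  nonneg : ∀ z, 0 ≤ F z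
  exists_le : ∃ L, ∀ z, F z ≤ L
  upperSemicontinuousOn : UpperSemicontinuousOn F Ω
  subMean : SubMean Ω F

lemma volume_preimage_affine_eq_zero {s : ℝ} (hs : s ≠ 0) (a : ℂ) {S : Set ℂ} :
    volume ((fun v : ℂ => a + s • v) ⁻¹' S) = 0 ↔ volume S = 0 := by
  have : (fun v : ℂ => a + s • v) ⁻¹' S = (s • ·) ⁻¹' ((fun w => a + w) ⁻¹' S) := rfl
  rw [this, Measure.addHaar_preimage_smul _ hs, measure_preimage_add]
  simp [hs]

lemma add_smul_mem_ball {a v : ℂ} {s : ℝ} (hs : 0 < s) (hv : v ∈ ball (0 : ℂ) 1) :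
    a + s • v ∈ ball a s := by
  rw [mem_ball_iff_norm, add_sub_cancel_left, norm_smul, Real.norm_of_nonneg hs.le]
  have := mem_ball_zero_iff.1 hv
  nlinarith

/-- A strict form of the sub-mean-value inequality: large values are taken on a set of positive
measure. -/
lemma IsBoundedSubMean.volume_lt_ne_zero {Ω : Set ℂ} {F : ℂ → ℝ} (hF : IsBoundedSubMean Ω F)
    {a : ℂ} {s m : ℝ} (hs : 0 < s) (ha : closedBall a s ⊆ Ω) (hm : m < F a) :
    volume {w ∈ ball a s | m < F w} ≠ 0 := by
  intro h0
  obtain ⟨L, hL⟩ := hF.exists_le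
  have h1 : ∀ᵐ v ∂(volume.restrict (ball (0 : ℂ) 1)), F (a + s • v) ≤ m := by
    rw [ae_restrict_iff' measurableSet_ball]
    have := (volume_preimage_affine_eq_zero hs.ne' a).2 h0
    filter_upwards [measure_eq_zero_iff_ae_notMem.1 this] with v hv hv1
    by_contra hlt
    exact hv ⟨add_smul_mem_ball hs hv1, not_le.1 hlt⟩
  have hint : IntegrableOn (fun v : ℂ => F (a + s • v)) (ball 0 1) := by
    have := hF.measurable
    refine Measure.integrableOn_of_bounded (M := L) measure_ball_lt_top.ne
      (Measurable.aestronglyMeasurable (by fun_prop)) (Eventually.of_forall fun v => ?_)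
    rw [Real.norm_of_nonneg (hF.nonneg _)]; exact hL _
  have h2 := integral_mono_ae hint (integrableOn_ball_const 0 1 m) h1
  have h3 := hF.subMean a s hs ha
  simp only [integral_const, measureReal_restrict_apply_univ, volume_real_unit_ball,
    smul_eq_mul] at h2
  have := lt_of_mul_lt_mul_left ((mul_lt_mul_of_pos_left hm Real.pi_pos).trans_le (h3.trans h2))
    Real.pi_pos.le
  exact lt_irrefl _ this

/-- A displacement by `n * t` is `n` displacements by `t`; the positive part is subadditive, and the
intermediate points stay in the disk of radius `r / 2`. -/
lemma lintegral_ball_telescope {F : ℂ → ℝ} (hF : Measurable F) {r t : ℝ} (n : ℕ) (ht : 0 ≤ t)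
    (hnt : n * t ≤ r / 4) {v : ℂ} (hv : ‖v‖ < 1) :
    ∫⁻ z in ball (0 : ℂ) (r / 4), ENNReal.ofReal (F (z + (n * t) • v) - F z) ≤
      n * ∫⁻ z in ball (0 : ℂ) (r / 2), ENNReal.ofReal (F (z + t • v) - F z) := by
  have hstep : ∀ z, ENNReal.ofReal (F (z + (n * t) • v) - F z) ≤
      ∑ m ∈ Finset.range n, ENNReal.ofReal (F (z + (m * t) • v + t • v) - F (z + (m * t) • v)) := by
    intro z
    have : F (z + (n * t) • v) - F z =
        ∑ m ∈ Finset.range n, (F (z + (m * t) • v + t • v) - F (z + (m * t) • v)) := by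
      have h := Finset.sum_range_sub (fun m : ℕ => F (z + (m * t) • v)) n
      simp only [Nat.cast_zero, zero_mul, zero_smul, add_zero] at h
      rw [← h]
      refine Finset.sum_congr rfl fun m _ => ?_
      congr 2
      push_cast
      rw [add_mul, one_mul, add_smul, add_assoc]
    rw [this]
    exact Finset.le_sum_of_subadditive _ ENNReal.ofReal_zero.le (fun _ _ => ENNReal.ofReal_add_le) _ _
  calc _ ≤ ∫⁻ z in ball (0 : ℂ) (r / 4), ∑ m ∈ Finset.range n,
        ENNReal.ofReal (F (z + (m * t) • v + t • v) - F (z + (m * t) • v)) :=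
        lintegral_mono hstep
    _ = ∑ m ∈ Finset.range n, ∫⁻ z in ball (0 : ℂ) (r / 4),
        ENNReal.ofReal (F (z + (m * t) • v + t • v) - F (z + (m * t) • v)) :=
        lintegral_finsetSum _ (fun m _ => by fun_prop)
    _ ≤ ∑ m ∈ Finset.range n, ∫⁻ z in ball (0 : ℂ) (r / 2),
        ENNReal.ofReal (F (z + t • v) - F z) := by
        refine Finset.sum_le_sum fun m hm => ?_
        rw [← lintegral_indicator measurableSet_ball, ← lintegral_indicator measurableSet_ball,
          ← lintegral_add_right_eq_self ((ball (0 : ℂ) (r / 2)).indicator fun z =>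
            ENNReal.ofReal (F (z + t • v) - F z)) ((m * t) • v)]
        refine lintegral_mono fun z => ?_
        by_cases hz : z ∈ ball (0 : ℂ) (r / 4)
        · have hmn : (m : ℝ) * t ≤ n * t :=
            mul_le_mul_of_nonneg_right (by exact_mod_cast (Finset.mem_range.1 hm).le) ht
          have : z + (m * t) • v ∈ ball (0 : ℂ) (r / 2) := by
            rw [mem_ball_zero_iff] at hz ⊢
            have h1 := norm_add_le z ((m * t) • v)
            have h0 : 0 ≤ (m : ℝ) * t := by positivity
            rw [norm_smul, Real.norm_of_nonneg h0] at h1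
            nlinarith [norm_nonneg v]
          rw [indicator_of_mem hz, indicator_of_mem this]
        · rw [indicator_of_notMem hz]; exact bot_le
    _ = _ := by simp

/-- Monotonicity along an open cone of directions extends across closed null sets, for bounded
functions satisfying the sub-mean-value inequality: the almost everywhere version. -/
lemma IsBoundedSubMean.ae_add_le {r : ℝ} (hr : 0 < r) {F : ℂ → ℝ}
    (hF : IsBoundedSubMean (ball 0 r) F) {K : Set ℂ} (hK : IsClosed K)
    (hK0 : volume (ball 0 r ∩ K) = 0) {C : Set ℂ} (hC : IsOpen C)
    (hCs : ∀ t : ℝ, 0 < t → ∀ v ∈ C, t • v ∈ C)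
    (hseg : ∀ z, ∀ v ∈ C, segment ℝ z (z + v) ⊆ ball 0 r \ K → F (z + v) ≤ F z) :
    ∀ᵐ v : ℂ, v ∈ C ∩ ball 0 1 → ∀ᵐ z : ℂ, z ∈ ball (0 : ℂ) (r / 4) →
      F (z + (r / 4) • v) ≤ F z := by
  obtain ⟨L, hL⟩ := hF.exists_le
  have hFm := hF.measurable
  obtain ⟨E, hE0, hE⟩ := exists_energy_le hr hF.measurable hF.nonneg hL hF.subMean
  set A := C ∩ ball (0 : ℂ) 1 with hA
  have hAm : MeasurableSet A := hC.measurableSet.inter measurableSet_ball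
  set K' := K ∩ closedBall (0 : ℂ) (3 * r / 4) with hK'
  have hKc : IsCompact K' := (isCompact_closedBall _ _).inter_left hK
  have hK0' : volume K' = 0 := by
    have : K' ⊆ ball 0 r ∩ K := fun z hz => ⟨closedBall_subset_ball (by linarith) hz.2, hz.1⟩
    exact measure_mono_null this hK0
  set I : ℝ → ENNReal := fun t => ∫⁻ v in A, ∫⁻ z in ball (0 : ℂ) (r / 2),
    ENNReal.ofReal (F (z + t • v) - F z) with hI
  -- Off the `t`-neighbourhood of `K'` the segment misses `K`, so the positive part vanishes. On it,
  -- `x ≤ x² / (λt) + λt`: the first term is controlled by the energy, the second by the measure of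
  -- the neighbourhood.
  have hIle : ∀ lam t : ℝ, 0 < lam → 0 < t → t ≤ r / 8 → I t ≤ ENNReal.ofReal t *
      (ENNReal.ofReal (E / lam) + ENNReal.ofReal (lam * Real.pi) *
        volume (cthickening t K')) := by
    intro lam t hlam ht htr
    have hpt : ∀ v ∈ A, ∀ z ∈ ball (0 : ℂ) (r / 2), ENNReal.ofReal (F (z + t • v) - F z) ≤
        ENNReal.ofReal (1 / (lam * t)) * ENNReal.ofReal ((F (z + t • v) - F z) ^ 2) +
        (cthickening t K').indicator (fun _ => ENNReal.ofReal (lam * t)) z := by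
      intro v hv z hz
      by_cases hzK : z ∈ cthickening t K'
      · rw [indicator_of_mem hzK, ← ENNReal.ofReal_mul (by positivity),
          ← ENNReal.ofReal_add (by positivity) (by positivity)]
        refine ENNReal.ofReal_le_ofReal ?_
        set x := F (z + t • v) - F z
        have hlt : 0 < lam * t := mul_pos hlam ht
        rw [one_div, ← sub_nonneg]
        have : (lam * t)⁻¹ * x ^ 2 + lam * t - x =
          (lam * t)⁻¹ * ((x - lam * t / 2) ^ 2 + 3 / 4 * (lam * t) ^ 2) := by
          field_simp; ring
        rw [this]; positivity
      · have : F (z + t • v) ≤ F z := by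
          refine hseg z _ (hCs t ht v hv.1) fun w hw => ?_
          have hd : dist z w ≤ t := by
            have hsub : segment ℝ z (z + t • v) ⊆ closedBall z t :=
              (convex_closedBall z t).segment_subset (mem_closedBall_self ht.le)
                (ball_subset_closedBall (add_smul_mem_ball ht hv.2))
            rw [dist_comm]; exact hsub hw
          have hw1 : ‖w‖ ≤ 3 * r / 4 := by
            have h1 := norm_le_norm_add_norm_sub z w
            rw [mem_ball_zero_iff] at hz
            rw [dist_comm, dist_eq_norm] at hd
            rw [norm_sub_rev] at h1
            linarith
          refine ⟨mem_ball_zero_iff.2 (by linarith), fun hwK => hzK ?_⟩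
          exact mem_cthickening_of_dist_le z w t K' ⟨hwK, mem_closedBall_zero_iff.2 hw1⟩ hd
        rw [ENNReal.ofReal_of_nonpos (by linarith)]; exact bot_le
    have hmc : MeasurableSet (cthickening t K') := isClosed_cthickening.measurableSet
    calc I t ≤ ∫⁻ v in A, ∫⁻ z in ball (0 : ℂ) (r / 2),
          (ENNReal.ofReal (1 / (lam * t)) * ENNReal.ofReal ((F (z + t • v) - F z) ^ 2) +
          (cthickening t K').indicator (fun _ => ENNReal.ofReal (lam * t)) z) :=
          setLIntegral_mono' hAm fun v hv => setLIntegral_mono' measurableSet_ball (hpt v hv)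
      _ ≤ ∫⁻ v in ball (0 : ℂ) 1, ∫⁻ z in ball (0 : ℂ) (r / 2),
          (ENNReal.ofReal (1 / (lam * t)) * ENNReal.ofReal ((F (z + t • v) - F z) ^ 2) +
          (cthickening t K').indicator (fun _ => ENNReal.ofReal (lam * t)) z) :=
          lintegral_mono_set inter_subset_right
      _ ≤ ∫⁻ v in ball (0 : ℂ) 1, (ENNReal.ofReal (1 / (lam * t)) *
          (∫⁻ z in ball (0 : ℂ) (r / 2), ENNReal.ofReal ((F (z + t • v) - F z) ^ 2)) +
          ENNReal.ofReal (lam * t) * volume (cthickening t K')) := by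
          refine lintegral_mono fun v => ?_
          simp only
          rw [lintegral_add_left (by fun_prop), lintegral_const_mul _ (by fun_prop)]
          refine add_le_add le_rfl ?_
          refine (setLIntegral_le_lintegral _ _).trans ?_
          rw [lintegral_indicator_const hmc]
      _ = ENNReal.ofReal (1 / (lam * t)) * (∫⁻ v in ball (0 : ℂ) 1,
          ∫⁻ z in ball (0 : ℂ) (r / 2), ENNReal.ofReal ((F (z + t • v) - F z) ^ 2)) +
          ENNReal.ofReal (lam * t) * volume (cthickening t K') * ENNReal.ofReal Real.pi := by
          have hm : Measurable fun v : ℂ =>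
              ∫⁻ z in ball (0 : ℂ) (r / 2), ENNReal.ofReal ((F (z + t • v) - F z) ^ 2) :=
            Measurable.lintegral_prod_right' (f := fun p : ℂ × ℂ =>
              ENNReal.ofReal ((F (p.2 + t • p.1) - F p.2) ^ 2)) (by fun_prop)
          rw [lintegral_add_right _ measurable_const, lintegral_const_mul _ hm]
          congr 1
          rw [lintegral_const, Measure.restrict_apply_univ, ← volume_real_unit_ball, Measure.real,
            ENNReal.ofReal_toReal measure_ball_lt_top.ne]
      _ ≤ ENNReal.ofReal (1 / (lam * t)) * ENNReal.ofReal (E * t ^ 2) +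
          ENNReal.ofReal (lam * t) * volume (cthickening t K') * ENNReal.ofReal Real.pi :=
          add_le_add (mul_le_mul_right (hE t ht htr) _) le_rfl
      _ = _ := by
          rw [mul_add, ← ENNReal.ofReal_mul (by positivity), ← ENNReal.ofReal_mul ht.le,
            mul_right_comm, ← ENNReal.ofReal_mul (by positivity), ← mul_assoc (ENNReal.ofReal t),
            ← ENNReal.ofReal_mul ht.le]
          congr 2
          · field_simp
          · congr 1; ring
  set J : ENNReal := ∫⁻ v in A, ∫⁻ z in ball (0 : ℂ) (r / 4),
    ENNReal.ofReal (F (z + (r / 4) • v) - F z) with hJ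
  have hJI : ∀ n : ℕ, 2 ≤ n → J ≤ n * I ((r / 4) / n) := by
    intro n hn
    have hn0 : (n : ℝ) ≠ 0 := by positivity
    have hm : Measurable fun v : ℂ => ∫⁻ z in ball (0 : ℂ) (r / 2),
        ENNReal.ofReal (F (z + (r / 4 / n) • v) - F z) :=
      Measurable.lintegral_prod_right' (f := fun p : ℂ × ℂ =>
        ENNReal.ofReal (F (p.2 + (r / 4 / n) • p.1) - F p.2)) (by fun_prop)
    rw [hI, ← lintegral_const_mul _ hm]
    refine setLIntegral_mono' hAm fun v hv => ?_
    have := lintegral_ball_telescope hFm (r := r) (t := r / 4 / n) n (by positivity)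
      (by rw [mul_div_cancel₀ _ hn0]) (mem_ball_zero_iff.1 hv.2)
    rwa [mul_div_cancel₀ _ hn0] at this
  -- With `t = r / (4n)` the `n` steps cancel the factor `t` in the bound of `I t`. As `n → ∞`, the
  -- measure of the thickenings of the compact set `K'` tends to `0`. The requirement `n ≥ 2` is `t
  -- ≤ r / 8`.
  have hJlam : ∀ lam : ℝ, 0 < lam → J ≤ ENNReal.ofReal (r / 4) * ENNReal.ofReal (E / lam) := by
    intro lam hlam
    have hlim : Tendsto (fun n : ℕ => ENNReal.ofReal (r / 4) * (ENNReal.ofReal (E / lam) +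
        ENNReal.ofReal (lam * Real.pi) * volume (cthickening (r / 4 / n) K'))) atTop
        (𝓝 (ENNReal.ofReal (r / 4) * (ENNReal.ofReal (E / lam) +
          ENNReal.ofReal (lam * Real.pi) * 0))) := by
      refine ENNReal.Tendsto.const_mul (Tendsto.const_add _ (ENNReal.Tendsto.const_mul ?_
        (Or.inr ENNReal.ofReal_ne_top))) (Or.inr ENNReal.ofReal_ne_top)
      rw [← hK0']
      exact (tendsto_measure_cthickening_of_isCompact hKc).comp
        (tendsto_const_div_atTop_nhds_zero_nat _)
    rw [mul_zero, add_zero] at hlim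
    refine ge_of_tendsto hlim ?_
    filter_upwards [eventually_ge_atTop 2] with n hn
    have hn' : (2 : ℝ) ≤ n := by exact_mod_cast hn
    have hn0 : (0 : ℝ) < n := by linarith
    have h8 : r / 4 / n ≤ r / 8 := by
      rw [div_le_iff₀ hn0]; nlinarith
    refine (hJI n hn).trans ((mul_le_mul_right (hIle lam _ hlam (by positivity) h8) _).trans ?_)
    rw [← mul_assoc, ← ENNReal.ofReal_natCast, ← ENNReal.ofReal_mul (by positivity),
      mul_div_cancel₀ _ hn0.ne']
  have hJ0 : J = 0 := by
    have hlim : Tendsto (fun n : ℕ => ENNReal.ofReal (r / 4) * ENNReal.ofReal (E / n)) atTop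
        (𝓝 (ENNReal.ofReal (r / 4) * ENNReal.ofReal 0)) :=
      ENNReal.Tendsto.const_mul (ENNReal.tendsto_ofReal (tendsto_const_div_atTop_nhds_zero_nat E))
        (Or.inr ENNReal.ofReal_ne_top)
    rw [ENNReal.ofReal_zero, mul_zero] at hlim
    refine le_antisymm (ge_of_tendsto hlim ?_) bot_le
    filter_upwards [eventually_gt_atTop 0] with n hn
    exact hJlam n (by exact_mod_cast hn)
  have hm : Measurable fun v : ℂ => ∫⁻ z in ball (0 : ℂ) (r / 4),
      ENNReal.ofReal (F (z + (r / 4) • v) - F z) :=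
    Measurable.lintegral_prod_right' (f := fun p : ℂ × ℂ =>
      ENNReal.ofReal (F (p.2 + (r / 4) • p.1) - F p.2)) (by fun_prop)
  rw [hJ, lintegral_eq_zero_iff hm, EventuallyEq, ae_restrict_iff' hAm] at hJ0
  filter_upwards [hJ0] with v hv hvA
  have := hv hvA
  rw [Pi.zero_apply, lintegral_eq_zero_iff (by fun_prop), EventuallyEq,
    ae_restrict_iff' measurableSet_ball] at this
  filter_upwards [this] with z hz hzb
  simpa using hz hzb

lemma exists_ball_lt_of_upperSemicontinuousOn {F : ℂ → ℝ} {Ω : Set ℂ} (hΩ : IsOpen Ω)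
    (hF : UpperSemicontinuousOn F Ω) {z : ℂ} (hz : z ∈ Ω) {m : ℝ} (hm : F z < m) :
    ∃ δ > 0, ball z δ ⊆ Ω ∧ ∀ w ∈ ball z δ, F w < m := by
  have h1 := hF z hz m hm
  rw [hΩ.nhdsWithin_eq hz] at h1
  obtain ⟨δ, hδ, h⟩ := Metric.eventually_nhds_iff_ball.1 (h1.and (hΩ.mem_nhds hz))
  exact ⟨δ, hδ, fun w hw => (h w hw).2, fun w hw => (h w hw).1⟩

/-- Monotonicity along an open cone of directions extends across closed null sets, for bounded
functions satisfying the sub-mean-value inequality. -/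
lemma IsBoundedSubMean.add_le {r : ℝ} (hr : 0 < r) {F : ℂ → ℝ}
    (hF : IsBoundedSubMean (ball 0 r) F) {K : Set ℂ} (hK : IsClosed K)
    (hK0 : volume (ball 0 r ∩ K) = 0) {C : Set ℂ} (hC : IsOpen C)
    (hCs : ∀ t : ℝ, 0 < t → ∀ v ∈ C, t • v ∈ C)
    (hseg : ∀ z, ∀ v ∈ C, segment ℝ z (z + v) ⊆ ball 0 r \ K → F (z + v) ≤ F z)
    {z v : ℂ} (hz : z ∈ ball (0 : ℂ) (r / 4)) (hv : v ∈ C) (hvr : ‖v‖ < r / 4) :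
    F (z + v) ≤ F z := by
  by_contra! hlt
  obtain ⟨m, hm1, hm2⟩ := exists_between hlt
  have hzb : z ∈ ball (0 : ℂ) r := ball_subset_ball (by linarith) hz
  obtain ⟨δ, hδ, hδΩ, hδm⟩ := 
    exists_ball_lt_of_upperSemicontinuousOn isOpen_ball hF.upperSemicontinuousOn hzb hm1
  have hzvb : z + v ∈ ball (0 : ℂ) r := by
    rw [mem_ball_zero_iff] at hz ⊢
    linarith [norm_add_le z v]
  obtain ⟨δ₁, hδ₁, hδ₁b⟩ := nhds_basis_closedBall.mem_iff.1 (isOpen_ball.mem_nhds hzvb)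
  obtain ⟨δ₂, hδ₂, hδ₂b⟩ := Metric.mem_nhds_iff.1 (isOpen_ball.mem_nhds hz)
  set δ' := min δ₁ (min δ δ₂ / 2) with hδ'
  have hδ'0 : 0 < δ' := lt_min hδ₁ (half_pos (lt_min hδ hδ₂))
  have hpos := hF.volume_lt_ne_zero (a := z + v) (s := δ') (m := m) hδ'0
    ((closedBall_subset_closedBall (min_le_left _ _)).trans hδ₁b) hm2
  set P := {w ∈ ball (z + v) δ' | m < F w} with hP
  have hae := hF.ae_add_le hr hK hK0 hC hCs hseg
  -- directions close to `v`
  set T : Set ℂ := (fun u : ℂ => (r / 4) • u) ⁻¹'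
    (C ∩ ball 0 (r / 4) ∩ ball v (min δ δ₂ / 2)) with hT
  have hTo : IsOpen T := ((hC.inter isOpen_ball).inter isOpen_ball).preimage (by fun_prop)
  have hr4 : r / 4 ≠ 0 := by positivity
  have hTn : T.Nonempty := by
    refine ⟨(r / 4)⁻¹ • v, ?_⟩
    rw [hT, mem_preimage, smul_inv_smul₀ hr4]
    exact ⟨⟨hv, mem_ball_zero_iff.2 hvr⟩, mem_ball_self (half_pos (lt_min hδ hδ₂))⟩
  obtain ⟨u, huT, hu⟩ : ∃ u ∈ T, ∀ᵐ z : ℂ, z ∈ ball (0 : ℂ) (r / 4) →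
      F (z + (r / 4) • u) ≤ F z := by
    by_contra hcon
    refine (hTo.measure_pos volume hTn).ne' (measure_mono_null ?_ (ae_iff.1 hae))
    intro u hu hcon'
    refine hcon ⟨u, hu, hcon' ⟨?_, ?_⟩⟩
    · have := hCs (r / 4)⁻¹ (by positivity) _ hu.1.1
      rwa [inv_smul_smul₀ hr4] at this
    · have := mem_ball_zero_iff.1 hu.1.2
      rw [norm_smul, Real.norm_of_nonneg (by positivity)] at this
      rw [mem_ball_zero_iff]
      by_contra! h1
      nlinarith
  -- Near `z` one has `F < m` by semicontinuity, while `F > m` on a set of positive measure near `z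
  -- + v`. Translated back by a good direction close to `v`, this set consists of exceptional points
  -- of that direction.
  refine hpos (measure_mono_null (t := (fun w => w - (r / 4) • u) ⁻¹'
    {z | ¬ (z ∈ ball (0 : ℂ) (r / 4) → F (z + (r / 4) • u) ≤ F z)}) ?_ ?_)
  · intro w hw
    have hd : w - (r / 4) • u ∈ ball z (min δ δ₂) := by
      rw [mem_ball_iff_norm]
      have h1 := mem_ball_iff_norm.1 hw.1
      have h2 := mem_ball_iff_norm.1 huT.2
      have h3 : δ' ≤ min δ δ₂ / 2 := min_le_right _ _
      calc ‖w - (r / 4) • u - z‖ = ‖(w - (z + v)) - ((r / 4) • u - v)‖ := by congr 1; abel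
        _ ≤ _ := norm_sub_le _ _
        _ < _ := by linarith
    simp only [mem_preimage, mem_ofPred_eq, sub_add_cancel, Classical.not_imp, not_le]
    refine ⟨hδ₂b (ball_subset_ball (min_le_right _ _) hd), ?_⟩
    exact (hδm _ (ball_subset_ball (min_le_left _ _) hd)).trans hw.2
  · simp only [sub_eq_add_neg]
    rw [measure_preimage_add_right]
    exact ae_iff.1 hu

/-! ### Truncations of `V - H` -/

/-- The function `max (V - H, M)`, which is real-valued where `V < ∞`. -/
noncomputable def trunc (V : ℂ → EReal) (H : ℂ → ℝ) (M : ℝ) (z : ℂ) : ℝ :=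
  (max (V z) ((H z + M : ℝ) : EReal)).toReal - H z

section trunc

variable {V : ℂ → EReal} {H : ℂ → ℝ} {M m : ℝ} {z : ℂ}

lemma coe_trunc_add (hz : V z < ⊤) :
    ((trunc V H M z + H z : ℝ) : EReal) = max (V z) ((H z + M : ℝ) : EReal) := by
  rw [trunc, sub_add_cancel, EReal.coe_toReal]
  · exact (max_lt hz (EReal.coe_lt_top _)).ne
  · exact ((EReal.bot_lt_coe _).trans_le (le_max_right _ _)).ne'

lemma trunc_lt_iff (hz : V z < ⊤) :
    trunc V H M z < m ↔ V z < ((H z + m : ℝ) : EReal) ∧ M < m := by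
  rw [← add_lt_add_iff_right (H z), ← EReal.coe_lt_coe_iff, coe_trunc_add hz, max_lt_iff,
    EReal.coe_lt_coe_iff, add_comm m]
  simp

/-- Through this equivalence, inequalities for `V`, which may be `-∞`, are exchanged for real
inequalities: the level `M` can be chosen to fit the bound `m`. -/
lemma trunc_le_iff (hz : V z < ⊤) :
    trunc V H M z ≤ m ↔ V z ≤ ((H z + m : ℝ) : EReal) ∧ M ≤ m := by
  rw [← add_le_add_iff_right (H z), ← EReal.coe_le_coe_iff, coe_trunc_add hz, max_le_iff,
    EReal.coe_le_coe_iff, add_comm m]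
  simp

lemma le_trunc (hz : V z < ⊤) : M ≤ trunc V H M z := ((trunc_le_iff hz).1 le_rfl).2

end trunc

lemma measurable_piecewise_of_upperSemicontinuousOn {β : Type*} [LinearOrder β]
    [TopologicalSpace β] [OrderTopology β] [SecondCountableTopology β] [MeasurableSpace β]
    [BorelSpace β] {f : ℂ → β} {Ω : Set ℂ} [∀ z, Decidable (z ∈ Ω)] (hΩ : IsOpen Ω)
    (hf : UpperSemicontinuousOn f Ω) (c : β) : Measurable (Ω.piecewise f fun _ => c) := by
  refine measurable_of_Iio fun m => ?_
  have ho : IsOpen (f ⁻¹' Iio m ∩ Ω) := by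
    refine isOpen_iff_mem_nhds.2 fun z hz => ?_
    have h1 := hf z hz.2 m hz.1
    rw [hΩ.nhdsWithin_eq hz.2] at h1
    exact h1.and (hΩ.mem_nhds hz.2)
  rw [piecewise_preimage, Set.ite]
  exact ho.measurableSet.union ((measurable_const measurableSet_Iio).diff hΩ.measurableSet)

lemma upperSemicontinuousOn_trunc {Ω : Set ℂ} {V : ℂ → EReal} {H : ℂ → ℝ}
    (hV : UpperSemicontinuousOn V Ω) (hVt : ∀ z ∈ Ω, V z < ⊤) (hH : ContinuousOn H Ω) (M : ℝ) :
    UpperSemicontinuousOn (trunc V H M) Ω := by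
  intro z hz m hm
  rw [trunc_lt_iff (hVt z hz)] at hm
  obtain ⟨q, hq1, hq2⟩ := exists_between hm.1
  have h1 := hV z hz q hq1
  have h2 : ∀ᶠ w in 𝓝[Ω] z, q < ((H w + m : ℝ) : EReal) := by
    have : Tendsto (fun w => ((H w + m : ℝ) : EReal)) (𝓝[Ω] z) (𝓝 ((H z + m : ℝ) : EReal)) :=
      (continuous_coe_real_ereal.tendsto _).comp ((hH z hz).add_const m)
    exact this.eventually_const_lt hq2
  filter_upwards [h1, h2, self_mem_nhdsWithin] with w hw1 hw2 hw
  exact (trunc_lt_iff (hVt w hw)).2 ⟨hw1.trans hw2, hm.2⟩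

section Subharmonic

variable {R r : ℝ} {V : ℂ → EReal}

lemma IsSubharmonic.measurable_indicator_trunc (hV : IsSubharmonic (disk R) V) (hrR : r ≤ R)
    {H : ℂ → ℝ} (hH : ContinuousOn H (ball 0 R)) (M c : ℝ) :
    Measurable ((ball (0 : ℂ) r).indicator fun z => trunc V H M z + c) := by
  classical
  rw [← piecewise_eq_indicator]
  have h1 := (upperSemicontinuousOn_trunc hV.upperSemicontinuousOn
    hV.lt_top hH M).mono (ball_subset_ball hrR)
  have h2 : UpperSemicontinuousOn (fun z => trunc V H M z + c) (ball (0 : ℂ) r) := by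
    intro z hz m hm
    filter_upwards [h1 z hz (m - c) (by linarith)] with w hw
    linarith
  exact measurable_piecewise_of_upperSemicontinuousOn isOpen_ball h2 0

lemma IsSubharmonic.exists_trunc_le (hV : IsSubharmonic (disk R) V) (hrR : r < R)
    {H : ℂ → ℝ} (hH : ContinuousOn H (ball 0 R)) (M : ℝ) :
    ∃ L, ∀ z ∈ closedBall (0 : ℂ) r, trunc V H M z ≤ L := by
  have h1 := (upperSemicontinuousOn_trunc hV.upperSemicontinuousOn
    hV.lt_top hH M).mono (closedBall_subset_ball hrR)
  obtain ⟨L, hL⟩ := h1.bddAbove_of_isCompact (isCompact_closedBall 0 r)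
  exact ⟨L, fun z hz => hL ⟨z, hz, rfl⟩⟩

/-- Truncations of `V - H` from below satisfy the hypotheses of the monotonicity theorem. -/
lemma IsSubharmonic.isBoundedSubMean (hV : IsSubharmonic (disk R) V) (hrR : r < R)
    {H : ℂ → ℝ} (hH : HarmonicOnNhd H (ball 0 R)) (M : ℝ) :
    IsBoundedSubMean (ball 0 r) ((ball (0 : ℂ) r).indicator fun z => trunc V H M z + -M) := by
  have hHc : ContinuousOn H (ball 0 R) := hH.contDiffOn.continuousOn
  have hbb : ball (0 : ℂ) r ⊆ ball 0 R := ball_subset_ball hrR.le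
  obtain ⟨L, hL⟩ := hV.exists_trunc_le hrR hHc M
  have hlt : ∀ z ∈ ball (0 : ℂ) r, V z < ⊤ := fun z hz => hV.lt_top z (hbb hz)
  set G := (ball (0 : ℂ) r).indicator fun z => trunc V H M z + -M with hG
  have hGm : Measurable G := hV.measurable_indicator_trunc hrR.le hHc M (-M)
  have hG0 : ∀ z, 0 ≤ G z := fun z => indicator_nonneg (fun w hw => by
    linarith [le_trunc (H := H) (M := M) (hlt w hw)]) z
  have hGL : ∀ z, G z ≤ |L - M| := fun z => by
    by_cases hz : z ∈ ball (0 : ℂ) r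
    · rw [hG, indicator_of_mem hz]
      linarith [hL z (ball_subset_closedBall hz), le_abs_self (L - M)]
    · rw [hG, indicator_of_notMem hz]; positivity
  refine ⟨hGm, hG0, ⟨_, hGL⟩, ?_, ?_⟩
  · intro z hz m hm
    rw [hG, indicator_of_mem hz] at hm
    have := (upperSemicontinuousOn_trunc hV.upperSemicontinuousOn
      hV.lt_top hHc M).mono hbb z hz (m + M) (by linarith)
    filter_upwards [this, self_mem_nhdsWithin] with w hw hwr
    rw [hG, indicator_of_mem hwr]; linarith
  · intro a s hs has
    refine le_integral_ball_of_le_circleAverage hGm (L := |L - M|) hs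
      (fun z _ => by rw [abs_of_nonneg (hG0 z)]; exact hGL z) fun ρ hρ hρs => ?_
    have har : a ∈ ball (0 : ℂ) r := has (mem_closedBall_self hs.le)
    have hcb : closedBall a ρ ⊆ ball 0 r := (closedBall_subset_closedBall hρs.le).trans has
    have hsr : sphere a |ρ| ⊆ ball 0 r := by
      rw [abs_of_pos hρ]; exact sphere_subset_closedBall.trans hcb
    have hGi : CircleIntegrable G a ρ :=
      circleIntegrable_of_bounded hGm fun z _ => by rw [abs_of_nonneg (hG0 z)]; exact hGL z
    have hHi : CircleIntegrable H a ρ := by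
      refine ContinuousOn.circleIntegrable' (hHc.mono (hsr.trans hbb))
    have hMi : CircleIntegrable (fun _ : ℂ => M) a ρ := circleIntegrable_const _ _ _
    have hGMi : CircleIntegrable (fun z => G z + M) a ρ := hGi.add hMi
    -- Subharmonicity is formulated with constant truncations, but here the truncation is at `H +
    -- M`. A constant `b ≤ H` on the disk gives `max (V, b + M) ≤ max (V, H + M) = H + (G + M)` on
    -- the circle, and the circle mean of `H` is `H a`.
    obtain ⟨b, hb⟩ : ∃ b, ∀ z ∈ closedBall a ρ, b ≤ H z := by
      obtain ⟨b, hb⟩ := ((isCompact_closedBall a ρ).image_of_continuousOn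
        (hHc.mono (hcb.trans hbb))).bddBelow
      exact ⟨b, fun z hz => hb ⟨z, hz, rfl⟩⟩
    have key : trunc V H M a ≤ Real.circleAverage G a ρ + M := by
      rw [trunc_le_iff (hlt a har)]
      constructor
      · refine (hV.le_circleAverage a ρ hρ (hcb.trans hbb) (b + M)).trans ?_
        rw [EReal.coe_le_coe_iff]
        set N := (ball (0 : ℂ) r).indicator fun z => trunc V (fun _ => 0) (b + M) z + 0 with hN
        have hNm : Measurable N := hV.measurable_indicator_trunc hrR.le continuousOn_const _ _
        obtain ⟨L', hL'⟩ := hV.exists_trunc_le hrR (H := fun _ => 0) continuousOn_const (b + M)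
        have hNe : ∀ z ∈ ball (0 : ℂ) r, N z = (max (V z) ((b + M : ℝ) : EReal)).toReal := by
          intro z hz
          rw [hN, indicator_of_mem hz, trunc]; simp
        have hNi : CircleIntegrable N a ρ := by
          refine circleIntegrable_of_bounded hNm (L := |L'| + |b + M|) fun z hz => ?_
          rw [hN, indicator_of_mem (hsr hz)]
          have h1 := hL' z (ball_subset_closedBall (hsr hz))
          have h2 := le_trunc (H := fun _ => 0) (M := b + M) (hlt z (hsr hz))
          rw [abs_le]
          constructor
          · linarith [neg_abs_le (b + M), abs_nonneg L']
          · linarith [le_abs_self L', abs_nonneg (b + M)]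
        rw [Real.circleAverage_congr_sphere (f₂ := N) fun z hz => (hNe z (hsr hz)).symm]
        have hHa : Real.circleAverage H a ρ = H a :=
          InnerProductSpace.HarmonicOnNhd.circleAverage_eq fun z hz => hH z (by
            rw [abs_of_pos hρ] at hz; exact hbb (hcb hz))
        have hsum : H a + (Real.circleAverage G a ρ + M) =
            Real.circleAverage (fun z => H z + (G z + M)) a ρ := by
          rw [Real.circleAverage_fun_add hHi hGMi, hHa,
            Real.circleAverage_fun_add hGi hMi, Real.circleAverage_const]
        rw [hsum]
        refine Real.circleAverage_mono hNi (hHi.add hGMi) fun z hz => ?_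
        have hzr := hsr hz
        have h1 : H z + (G z + M) = trunc V H M z + H z := by
          rw [hG, indicator_of_mem hzr]; ring
        rw [h1, ← EReal.coe_le_coe_iff, coe_trunc_add (hlt z hzr), hNe z hzr, EReal.coe_toReal]
        · refine max_le_max le_rfl ?_
          rw [EReal.coe_le_coe_iff]
          have := hb z (by rw [abs_of_pos hρ] at hz; exact sphere_subset_closedBall hz)
          linarith
        · exact (max_lt (hlt z hzr) (EReal.coe_lt_top _)).ne
        · exact ((EReal.bot_lt_coe _).trans_le (le_max_right _ _)).ne'
      · have : 0 ≤ Real.circleAverage G a ρ :=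
          Real.circleAverage_nonneg_of_nonneg fun z _ => hG0 z
        linarith
    rw [hG, indicator_of_mem har]
    linarith

/-- A subharmonic function which is almost everywhere equal to a continuous function is equal
to it. -/
lemma IsSubharmonic.eq_of_ae_eq (hV : IsSubharmonic (disk R) V) (hrR : r < R) {U : Set ℂ}
    (hU : IsOpen U) (hUr : U ⊆ ball 0 r) {N : ℂ → ℝ} (hN : ContinuousOn N U)
    (h : ∀ᵐ z : ℂ, z ∈ U → V z = N z) {z : ℂ} (hz : z ∈ U) : V z = N z := by
  have hzR : z ∈ ball (0 : ℂ) R := ball_subset_ball hrR.le (hUr hz)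
  have hNz := hN.continuousAt (hU.mem_nhds hz)
  rcases lt_trichotomy (V z) (N z) with hlt | heq | hlt
  · exfalso
    obtain ⟨m, hm1, hm2⟩ := EReal.lt_iff_exists_real_btwn.1 hlt
    rw [EReal.coe_lt_coe_iff] at hm2
    have h1 := hV.upperSemicontinuousOn z hzR m hm1
    rw [show ((disk R : Set ℂ)) = ball 0 R from rfl, isOpen_ball.nhdsWithin_eq hzR] at h1
    obtain ⟨δ, hδ, hb⟩ := Metric.eventually_nhds_iff_ball.1
      (h1.and ((hNz.eventually_const_lt hm2).and (hU.mem_nhds hz)))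
    refine (measure_ball_pos volume z hδ).ne' (measure_mono_null ?_ (ae_iff.1 h))
    intro w hw hcon
    obtain ⟨h1, h2, h3⟩ := hb w hw
    rw [hcon h3, EReal.coe_lt_coe_iff] at h1
    linarith
  · exact heq
  · exfalso
    obtain ⟨m, hm1, hm2⟩ := EReal.lt_iff_exists_real_btwn.1 hlt
    rw [EReal.coe_lt_coe_iff] at hm1
    obtain ⟨δ, hδ, hb⟩ := Metric.eventually_nhds_iff_ball.1
      ((hNz.eventually_lt_const hm1).and (hU.mem_nhds hz))
    -- At truncation level `m - 1`, with the shift that makes the function nonnegative, the value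
    -- `1` corresponds to `V = m`.
    have hsub := hV.isBoundedSubMean hrR (H := fun _ => 0)
      (fun x _ => harmonicAt_const 0) (m - 1)
    have hball : closedBall z (δ / 2) ⊆ U := fun w hw =>
      (hb w (closedBall_subset_ball (by linarith) hw)).2
    refine hsub.volume_lt_ne_zero (a := z) (s := δ / 2) (m := 1) (by positivity)
      (hball.trans hUr) ?_ (measure_mono_null ?_ (ae_iff.1 h))
    · rw [indicator_of_mem (hUr hz)]
      by_contra! hle
      have := ((trunc_le_iff (m := m) (hV.lt_top z hzR)).1 (by linarith)).1
      simp only [zero_add] at this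
      exact absurd hm2 (not_lt.2 this)
    · intro w hw hcon
      have hwU : w ∈ U := hball (ball_subset_closedBall hw.1)
      have hw2 := hw.2
      rw [indicator_of_mem (hUr hwU)] at hw2
      have hlt : trunc V (fun _ => 0) (m - 1) w < m := by
        rw [trunc_lt_iff (hV.lt_top w (ball_subset_ball hrR.le (hUr hwU))), hcon hwU,
          EReal.coe_lt_coe_iff]
        refine ⟨?_, by linarith⟩
        have := (hb w (ball_subset_ball (by linarith) hw.1)).1
        linarith
      linarith

end Subharmonic

/-! ### Local integrability of subharmonic functions -/

lemma lintegral_ball_add_smul {f : ℂ → ENNReal} (hf : Measurable f) (a : ℂ) {s : ℝ} (hs : 0 < s) :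
    ∫⁻ z in ball a s, f z = ENNReal.ofReal (s ^ 2) * ∫⁻ v in ball (0 : ℂ) 1, f (a + s • v) := by
  have hg : Measurable ((ball a s).indicator f) := hf.indicator measurableSet_ball
  have h1 : ∫⁻ v in ball (0 : ℂ) 1, f (a + s • v) =
      ∫⁻ v : ℂ, (fun w => (ball a s).indicator f (a + w)) (s • v) := by
    rw [← lintegral_indicator measurableSet_ball]
    refine lintegral_congr fun v => ?_
    beta_reduce
    by_cases hv : v ∈ ball (0 : ℂ) 1
    · rw [indicator_of_mem hv, indicator_of_mem (add_smul_mem_ball hs hv)]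
    · rw [indicator_of_notMem hv, indicator_of_notMem]
      rw [mem_ball_zero_iff, not_lt] at hv
      rw [mem_ball_iff_norm, add_sub_cancel_left, norm_smul, Real.norm_of_nonneg hs.le]
      nlinarith
  have h2 := lintegral_map (μ := (volume : Measure ℂ)) (f := fun w => (ball a s).indicator f (a + w))
    (g := fun v : ℂ => s • v) (by fun_prop) (by fun_prop)
  rw [Measure.map_addHaar_smul _ hs.ne', lintegral_smul_measure,
    lintegral_add_left_eq_self _ a, lintegral_indicator measurableSet_ball] at h2
  rw [h1, ← h2, Complex.finrank_real_complex, abs_of_nonneg (by positivity), smul_eq_mul,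
    ← mul_assoc, ← ENNReal.ofReal_mul (by positivity), mul_inv_cancel₀ (by positivity),
    ENNReal.ofReal_one, one_mul]

section Integrability

variable {R r : ℝ} {V : ℂ → EReal}

/-- A nonnegative function with values in `[0, ∞]` whose local integrability controls that of a
subharmonic function: up to the additive constant `L` it is `-V`. -/
noncomputable def negPart (V : ℂ → EReal) (r L : ℝ) (z : ℂ) : ENNReal :=
  ⨆ n : ℕ, (ball (0 : ℂ) r).indicator
    (fun z => ENNReal.ofReal (L - trunc V (fun _ => 0) (-n) z)) z

lemma trunc_antitone {H : ℂ → ℝ} {M M' : ℝ} (hM : M ≤ M') {z : ℂ} (hz : V z < ⊤) :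
    trunc V H M z ≤ trunc V H M' z := by
  rw [trunc_le_iff hz]
  exact ⟨((trunc_le_iff hz).1 le_rfl).1, hM.trans (le_trunc hz)⟩

lemma ne_bot_of_negPart_ne_top {L : ℝ} {z : ℂ} (hz : z ∈ ball (0 : ℂ) r)
    (h : negPart V r L z ≠ ⊤) : V z ≠ ⊥ := by
  intro hb
  refine h (ENNReal.eq_top_of_forall_nnreal_le fun x => ?_)
  obtain ⟨n, hn⟩ := exists_nat_ge (x - L : ℝ)
  refine le_trans ?_ (le_iSup _ n)
  rw [indicator_of_mem hz, trunc, hb]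
  simp only [zero_add, bot_le, sup_of_le_right, EReal.toReal_coe, sub_zero]
  rw [← ENNReal.ofReal_coe_nnreal]
  exact ENNReal.ofReal_le_ofReal (by linarith)

/-- The term `ENNReal.ofReal L` accounts for the points with `V z = ⊥`, where `toReal` takes the
default value `0`. -/
lemma ofReal_sub_toReal_le_negPart {L : ℝ} {z : ℂ} (hz : z ∈ ball (0 : ℂ) r) (ht : V z < ⊤) :
    ENNReal.ofReal (L - (V z).toReal) ≤ negPart V r L z + ENNReal.ofReal L := by
  by_cases hb : V z = ⊥
  · simp [hb]
  obtain ⟨n, hn⟩ := exists_nat_ge (-(V z).toReal)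
  refine le_add_right (le_trans ?_ (le_iSup _ n))
  rw [indicator_of_mem hz, trunc]
  have : (((-n : ℝ)) : EReal) ≤ V z := by
    rw [← EReal.coe_toReal ht.ne hb, EReal.coe_le_coe_iff]; linarith
  simp only [zero_add]
  rw [max_eq_left this, sub_zero]

lemma IsSubharmonic.measurable_indicator_sub_trunc (hV : IsSubharmonic (disk R) V) (hrR : r < R)
    {L : ℝ} (n : ℕ) : Measurable ((ball (0 : ℂ) r).indicator
      fun z => ENNReal.ofReal (L - trunc V (fun _ => 0) (-n) z)) := by
  have h1 := hV.measurable_indicator_trunc hrR.le (H := fun _ => 0) continuousOn_const (-n) 0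
  have : ((ball (0 : ℂ) r).indicator
      fun z => ENNReal.ofReal (L - trunc V (fun _ => 0) (-n) z)) =
      (ball (0 : ℂ) r).indicator fun z => ENNReal.ofReal (L - (ball (0 : ℂ) r).indicator
        (fun z => trunc V (fun _ => 0) (-n) z + 0) z) := by
    ext z
    by_cases hz : z ∈ ball (0 : ℂ) r <;> simp [hz]
  rw [this]
  exact Measurable.indicator (by fun_prop) measurableSet_ball

lemma IsSubharmonic.measurable_negPart (hV : IsSubharmonic (disk R) V) (hrR : r < R) {L : ℝ} :
    Measurable (negPart V r L) :=
  Measurable.iSup fun n => hV.measurable_indicator_sub_trunc hrR n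

/-- The area mean inequality at a point `a` with `V a` finite bounds the integrals of `L - max (V,
-n)` by `π s² (L - V a)`, uniformly in `n`; monotone convergence does the rest. -/
lemma IsSubharmonic.lintegral_negPart_lt_top (hV : IsSubharmonic (disk R) V) (hrR : r < R) {L : ℝ}
    (hL : ∀ z ∈ ball (0 : ℂ) r, V z ≤ L) (hL0 : 0 ≤ L)
    {a : ℂ} {s : ℝ} (hs : 0 < s) (has : closedBall a s ⊆ ball 0 r) (ha : V a ≠ ⊥) :
    ∫⁻ z in ball a s, negPart V r L z < ⊤ := by
  have hlt : ∀ z ∈ ball (0 : ℂ) r, V z < ⊤ := fun z hz => hV.lt_top z (ball_subset_ball hrR.le hz)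
  have har : a ∈ ball (0 : ℂ) r := has (mem_closedBall_self hs.le)
  have hm := hV.measurable_indicator_sub_trunc hrR (L := L)
  have hmono : Monotone fun (n : ℕ) => (ball (0 : ℂ) r).indicator
      fun z => ENNReal.ofReal (L - trunc V (fun _ => 0) (-n) z) := by
    intro n n' hnn z
    by_cases hz : z ∈ ball (0 : ℂ) r
    · simp only [indicator_of_mem hz]
      refine ENNReal.ofReal_le_ofReal (sub_le_sub_left (trunc_antitone ?_ (hlt z hz)) _)
      exact neg_le_neg (by exact_mod_cast hnn)
    · simp only [indicator_of_notMem hz, le_refl]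
  have hbound : ∀ n : ℕ, ∫⁻ z in ball a s, (ball (0 : ℂ) r).indicator
      (fun z => ENNReal.ofReal (L - trunc V (fun _ => 0) (-n) z)) z ≤
      ENNReal.ofReal (s ^ 2 * (Real.pi * (L - (V a).toReal))) := by
    intro n
    have hG := hV.isBoundedSubMean hrR (H := fun _ => 0) (fun x _ => harmonicAt_const 0) (-n)
    set G := (ball (0 : ℂ) r).indicator fun z => trunc V (fun _ => 0) (-n) z + - -(n : ℝ) with hGd
    obtain ⟨B, hB⟩ := hG.exists_le
    have hGm := hG.measurable
    have hGr : ∀ z ∈ ball (0 : ℂ) r, G z = trunc V (fun _ => 0) (-n) z + n := fun z hz => by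
      rw [hGd, indicator_of_mem hz]; ring
    have hscale : ∫⁻ z in ball a s, (ball (0 : ℂ) r).indicator
        (fun z => ENNReal.ofReal (L - trunc V (fun _ => 0) (-n) z)) z =
        ENNReal.ofReal (s ^ 2) * ∫⁻ v in ball (0 : ℂ) 1, ENNReal.ofReal (L + n - G (a + s • v)) := by
      rw [lintegral_ball_add_smul (hm n) a hs]
      congr 1
      refine setLIntegral_congr_fun measurableSet_ball fun v hv => ?_
      have hvr := has (ball_subset_closedBall (add_smul_mem_ball (a := a) hs hv))
      simp only [indicator_of_mem hvr, hGr _ hvr, add_sub_add_right_eq_sub]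
    have hint : IntegrableOn (fun v : ℂ => L + n - G (a + s • v)) (ball 0 1) := by
      refine (integrableOn_ball_const _ _ _).sub ?_
      refine Measure.integrableOn_of_bounded (M := B) measure_ball_lt_top.ne
        (Measurable.aestronglyMeasurable (by fun_prop)) (Eventually.of_forall fun v => ?_)
      rw [Real.norm_of_nonneg (hG.nonneg _)]; exact hB _
    have hGint : IntegrableOn (fun v : ℂ => G (a + s • v)) (ball 0 1) := by
      refine Measure.integrableOn_of_bounded (M := B) measure_ball_lt_top.ne
        (Measurable.aestronglyMeasurable (by fun_prop)) (Eventually.of_forall fun v => ?_)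
      rw [Real.norm_of_nonneg (hG.nonneg _)]; exact hB _
    have hnn : ∀ v ∈ ball (0 : ℂ) 1, 0 ≤ L + n - G (a + s • v) := by
      intro v hv
      have hvr := has (ball_subset_closedBall (add_smul_mem_ball (a := a) hs hv))
      rw [hGr _ hvr]
      have : trunc V (fun _ => 0) (-n) (a + s • v) ≤ L := by
        rw [trunc_le_iff (hlt _ hvr)]
        refine ⟨by simpa using hL _ hvr, ?_⟩
        have : (0 : ℝ) ≤ n := n.cast_nonneg
        linarith
      linarith
    rw [hscale, ← ofReal_integral_eq_lintegral_ofReal hint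
      ((ae_restrict_iff' measurableSet_ball).2 (Eventually.of_forall hnn)),
      ← ENNReal.ofReal_mul (by positivity)]
    refine ENNReal.ofReal_le_ofReal (mul_le_mul_of_nonneg_left ?_ (by positivity))
    rw [integral_sub (integrableOn_ball_const _ _ _) hGint]
    have h1 := hG.subMean a s hs has
    rw [hGr a har] at h1
    have h2 : (V a).toReal ≤ trunc V (fun _ => 0) (-n) a := by
      have := ((trunc_le_iff (m := trunc V (fun _ => 0) (-n) a) (hlt a har)).1 le_rfl).1
      rw [← EReal.coe_toReal (hlt a har).ne ha, EReal.coe_le_coe_iff] at this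
      simpa using this
    simp only [integral_const, measureReal_restrict_apply_univ, volume_real_unit_ball,
      smul_eq_mul]
    have := mul_le_mul_of_nonneg_left h2 Real.pi_pos.le
    nlinarith
  unfold negPart
  rw [lintegral_iSup hm hmono]
  exact (iSup_le hbound).trans_lt ENNReal.ofReal_lt_top

/-- Near every point of the disk a subharmonic function is integrable. -/
lemma IsSubharmonic.exists_lintegral_negPart_lt_top (hV : IsSubharmonic (disk R) V) (hrR : r < R)
    {L : ℝ} (hL : ∀ z ∈ ball (0 : ℂ) r, V z ≤ L) (hL0 : 0 ≤ L)
    (hne : ∃ z ∈ ball (0 : ℂ) r, V z ≠ ⊥) {z : ℂ} (hz : z ∈ ball (0 : ℂ) r) :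
    ∃ δ > 0, ∫⁻ w in ball z δ, negPart V r L w < ⊤ := by
  set U : Set ℂ := {z | ∃ δ > 0, ∫⁻ w in ball z δ, negPart V r L w < ⊤} with hU
  have hUo : IsOpen U := by
    refine Metric.isOpen_iff.2 fun z ⟨δ, hδ, h⟩ => ⟨δ / 2, by positivity, fun w hw => ?_⟩
    refine ⟨δ / 2, by positivity, (lintegral_mono_set ?_).trans_lt h⟩
    refine ball_subset_ball' ?_
    have := mem_ball.1 hw
    linarith
  -- `U` is open and meets the disk. It is also relatively closed: near a limit point there are
  -- points `b` with `V b` finite, and a disk around such a `b` with radius bounded below covers a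
  -- neighbourhood of the limit point.
  have hsub : ball (0 : ℂ) r ⊆ U := by
    refine (convex_ball (0 : ℂ) r).isPreconnected.subset_of_closure_inter_subset hUo ?_ ?_
    · obtain ⟨a, ha, hab⟩ := hne
      obtain ⟨s, hs, hsb⟩ := Metric.nhds_basis_closedBall.mem_iff.1 (isOpen_ball.mem_nhds ha)
      exact ⟨a, ha, s, hs, hV.lintegral_negPart_lt_top hrR hL hL0 hs hsb hab⟩
    · rintro a ⟨haU, har⟩
      obtain ⟨s, hs, hsb⟩ := Metric.nhds_basis_closedBall.mem_iff.1 (isOpen_ball.mem_nhds har)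
      obtain ⟨w, hwU, hw⟩ := Metric.mem_closure_iff.1 haU (s / 8) (by positivity)
      obtain ⟨δ, hδ, hfin⟩ := hwU
      obtain ⟨b, hb, hbne⟩ : ∃ b ∈ ball w (min δ (s / 8)), negPart V r L b ≠ ⊤ := by
        by_contra! hcon
        refine hfin.ne (top_unique ?_)
        calc ⊤ = ∫⁻ _ in ball w (min δ (s / 8)), (⊤ : ENNReal) := by
              rw [setLIntegral_const, ENNReal.top_mul (measure_ball_pos volume w
                (lt_min hδ (by positivity))).ne']
          _ = ∫⁻ b in ball w (min δ (s / 8)), negPart V r L b :=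
              setLIntegral_congr_fun measurableSet_ball fun b hb => (hcon b hb).symm
          _ ≤ _ := lintegral_mono_set (ball_subset_ball (min_le_left _ _))
      have hba : dist b a < s / 4 := by
        have h1 := (mem_ball.1 hb).trans_le (min_le_right _ _)
        rw [dist_comm] at hw
        linarith [dist_triangle b w a]
      have hbr : closedBall b (s / 2) ⊆ ball 0 r :=
        (closedBall_subset_closedBall' (by linarith)).trans hsb
      refine ⟨s / 4, by positivity, (lintegral_mono_set ?_).trans_lt
        (hV.lintegral_negPart_lt_top hrR hL hL0 (s := s / 2) (by positivity) hbr
          (ne_bot_of_negPart_ne_top (hbr (mem_closedBall_self (by positivity))) hbne))⟩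
      refine ball_subset_ball' ?_
      rw [dist_comm]; linarith
  exact hsub hz

lemma IsSubharmonic.exists_le (hV : IsSubharmonic (disk R) V) (hrR : r < R) :
    ∃ L : ℝ, 0 ≤ L ∧ ∀ z ∈ ball (0 : ℂ) r, V z ≤ L := by
  obtain ⟨L, hL⟩ := hV.exists_trunc_le hrR (H := fun _ => 0) continuousOn_const 0
  refine ⟨max L 0, le_max_right _ _, fun z hz => ?_⟩
  have := ((trunc_le_iff (hV.lt_top z (ball_subset_ball hrR.le hz))).1
    ((hL z (ball_subset_closedBall hz)).trans (le_max_left L 0))).1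
  simpa using this

lemma IsSubharmonic.ae_ne_bot (hV : IsSubharmonic (disk R) V) (hrR : r < R)
    (hne : ∃ z ∈ ball (0 : ℂ) r, V z ≠ ⊥) : ∀ᵐ z : ℂ, z ∈ ball (0 : ℂ) r → V z ≠ ⊥ := by
  obtain ⟨L, hL0, hL⟩ := hV.exists_le hrR
  rw [ae_iff]
  refine measure_null_of_locally_null _ fun z hz => ?_
  have hzr : z ∈ ball (0 : ℂ) r := by
    by_contra h
    exact hz fun h' => absurd h' h
  obtain ⟨δ, hδ, hfin⟩ := hV.exists_lintegral_negPart_lt_top hrR hL hL0 hne hzr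
  refine ⟨ball z δ ∩ {z | ¬ (z ∈ ball (0 : ℂ) r → V z ≠ ⊥)},
    inter_mem (mem_nhdsWithin_of_mem_nhds (ball_mem_nhds z hδ)) self_mem_nhdsWithin, ?_⟩
  have h1 := ae_lt_top (hV.measurable_negPart hrR) hfin.ne
  rw [ae_restrict_iff' measurableSet_ball] at h1
  refine measure_mono_null ?_ (ae_iff.1 h1)
  rintro w ⟨hw, hw'⟩ hcon
  exact hw' fun hwr => ne_bot_of_negPart_ne_top hwr (hcon hw).ne

lemma IsSubharmonic.locallyIntegrableOn (hV : IsSubharmonic (disk R) V) (hrR : r < R)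
    (hne : ∃ z ∈ ball (0 : ℂ) r, V z ≠ ⊥) :
    LocallyIntegrableOn (fun z => (V z).toReal) (ball 0 r) := by
  obtain ⟨L, hL0, hL⟩ := hV.exists_le hrR
  intro z hz
  obtain ⟨δ, hδ, hfin⟩ := hV.exists_lintegral_negPart_lt_top hrR hL hL0 hne hz
  refine ⟨ball z δ ∩ ball 0 r, inter_mem (mem_nhdsWithin_of_mem_nhds (ball_mem_nhds z hδ))
    self_mem_nhdsWithin, ?_, ?_⟩
  · classical
    have h1 : Measurable ((ball (0 : ℂ) r).piecewise V fun _ => 0) :=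
      measurable_piecewise_of_upperSemicontinuousOn isOpen_ball
        (hV.upperSemicontinuousOn.mono (ball_subset_ball hrR.le)) 0
    refine AEStronglyMeasurable.congr h1.ereal_toReal.aestronglyMeasurable ?_
    refine (ae_restrict_iff' (measurableSet_ball.inter measurableSet_ball)).2
      (Eventually.of_forall fun w hw => ?_)
    simp only [piecewise_eq_of_mem _ _ _ hw.2]
  · rw [HasFiniteIntegral]
    calc _ ≤ ∫⁻ w in ball z δ ∩ ball 0 r, (negPart V r L w + ENNReal.ofReal (2 * L)) := by
          refine setLIntegral_mono' (measurableSet_ball.inter measurableSet_ball) fun w hw => ?_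
          have ht := hV.lt_top w (ball_subset_ball hrR.le hw.2)
          have hle : (V w).toReal ≤ L := by
            by_cases hb : V w = ⊥
            · simpa [hb] using hL0
            · rw [← EReal.coe_le_coe_iff, EReal.coe_toReal ht.ne hb]; exact hL w hw.2
          have h1 := ofReal_sub_toReal_le_negPart (L := L) hw.2 ht
          calc ‖(V w).toReal‖ₑ = ENNReal.ofReal |(V w).toReal| := by
                rw [← Real.norm_eq_abs, ofReal_norm]
            _ ≤ ENNReal.ofReal ((L - (V w).toReal) + L) := by
                refine ENNReal.ofReal_le_ofReal (abs_le.2 ⟨by linarith, by linarith⟩)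
            _ ≤ ENNReal.ofReal (L - (V w).toReal) + ENNReal.ofReal L := ENNReal.ofReal_add_le
            _ ≤ negPart V r L w + ENNReal.ofReal L + ENNReal.ofReal L := add_le_add h1 le_rfl
            _ = _ := by rw [add_assoc, ← ENNReal.ofReal_add hL0 hL0, two_mul]
      _ ≤ ∫⁻ w in ball z δ, (negPart V r L w + ENNReal.ofReal (2 * L)) :=
          lintegral_mono_set inter_subset_left
      _ < ⊤ := by
          rw [lintegral_add_right _ measurable_const, setLIntegral_const]
          exact ENNReal.add_lt_top.2 ⟨hfin, ENNReal.mul_lt_top ENNReal.ofReal_lt_top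
            measure_ball_lt_top⟩

end Integrability

/-! ### From the distribution derivative to local constancy -/

lemma integrable_mul_of_tsupport_subset {f φ : ℂ → ℝ} {U : Set ℂ}
    (hf : LocallyIntegrableOn f U) (hφ : Continuous φ) (hc : HasCompactSupport φ)
    (hs : tsupport φ ⊆ U) : Integrable fun z => f z * φ z := by
  have h1 : IntegrableOn f (tsupport φ) := hf.integrableOn_compact_subset hs hc
  have h2 : IntegrableOn (fun z => f z * φ z) (tsupport φ) :=
    h1.mul_continuousOn hφ.continuousOn hc
  refine (integrableOn_iff_integrable_of_support_subset ?_).1 h2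
  intro z hz
  by_contra h
  exact hz (by simp [image_eq_zero_of_notMem_tsupport h])

lemma tsupport_fderiv_apply_subset (φ : ℂ → ℝ) (w : ℂ) :
    tsupport (fun z => fderiv ℝ φ z w) ⊆ tsupport φ := by
  refine closure_minimal (fun z hz => ?_) (isClosed_tsupport _)
  refine tsupport_fderiv_subset ℝ (subset_tsupport _ ?_)
  intro h
  exact hz (by simp [h])

/-- Du Bois-Reymond's lemma: an integrable function whose distribution derivative vanishes in a
disk is almost everywhere constant in a smaller disk. -/
lemma ae_eq_const_of_integral_fderiv_eq_zero {f : ℂ → ℝ} (hf : Integrable f) {a : ℂ} {δ : ℝ}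
    (hδ : 0 < δ)
    (h : ∀ φ : ℂ → ℝ, ContDiff ℝ ∞ φ → HasCompactSupport φ → tsupport φ ⊆ ball a (2 * δ) →
      ∀ w, ∫ z, f z * fderiv ℝ φ z w = 0) :
    ∃ c : ℝ, ∀ᵐ z : ℂ, z ∈ ball a δ → f z = c := by
  set ρ : ℕ → ContDiffBump (0 : ℂ) := fun n =>
    ⟨δ / (2 * (n + 2)), δ / (n + 2), by positivity, by
      apply div_lt_div_of_pos_left hδ (by positivity)
      have : (0 : ℝ) ≤ n := n.cast_nonneg
      linarith⟩ with hρ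
  have hout : ∀ n, (ρ n).rOut < δ := fun n => by
    have : (0 : ℝ) ≤ n := n.cast_nonneg
    change δ / (n + 2) < δ
    rw [div_lt_iff₀ (by positivity)]
    nlinarith
  set k : ℕ → ℂ → ℝ := fun n => (ρ n).normed volume ⋆[ContinuousLinearMap.lsmul ℝ ℝ, volume] f
    with hk
  have hder : ∀ n x, HasFDerivAt (k n) ((fderiv ℝ ((ρ n).normed volume)
      ⋆[(ContinuousLinearMap.lsmul ℝ ℝ).precompL ℂ, volume] f) x) x := fun n x =>
    ((ρ n).hasCompactSupport_normed).hasFDerivAt_convolution_left _ (ρ n).contDiff_normed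
      hf.locallyIntegrable x
  -- The derivative of the mollification at `x` is, up to sign, the hypothesis tested on `t ↦ ρₙ (x
  -- - t)`, whose support lies in the disk of radius `2 * δ` because the mollifier has radius less
  -- than `δ`.
  have hzero : ∀ n, ∀ x ∈ ball a δ, (fderiv ℝ ((ρ n).normed volume)
      ⋆[(ContinuousLinearMap.lsmul ℝ ℝ).precompL ℂ, volume] f) x = 0 := by
    intro n x hx
    ext w
    have hex : ConvolutionExistsAt (fderiv ℝ ((ρ n).normed volume)) f x
        ((ContinuousLinearMap.lsmul ℝ ℝ).precompL ℂ) volume :=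
      (((ρ n).hasCompactSupport_normed).fderiv ℝ).convolutionExists_left _
        (((ρ n).contDiff_normed (n := 1)).continuous_fderiv one_ne_zero) hf.locallyIntegrable x
    rw [convolution_eq_swap, ContinuousLinearMap.integral_apply hex.integrable_swap]
    set φ : ℂ → ℝ := fun t => (ρ n).normed volume (x - t) with hφ
    have hφs : ContDiff ℝ ∞ φ := (ρ n).contDiff_normed.comp (contDiff_const.sub contDiff_id)
    have hsupp : tsupport φ ⊆ closedBall x (ρ n).rOut := by
      refine closure_minimal (fun t ht => ?_) isClosed_closedBall
      have : x - t ∈ Function.support ((ρ n).normed volume) := ht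
      rw [(ρ n).support_normed_eq, mem_ball_zero_iff] at this
      rw [mem_closedBall_iff_norm, norm_sub_rev]; exact this.le
    have h0 := h φ hφs (HasCompactSupport.of_support_subset_isCompact (isCompact_closedBall x _)
      ((subset_tsupport _).trans hsupp)) (hsupp.trans fun t ht => by
        have h1 := mem_closedBall.1 ht
        have h2 := mem_ball.1 hx
        rw [mem_ball]
        linarith [dist_triangle t x a, hout n]) w
    have hd : ∀ t, fderiv ℝ φ t w = -(fderiv ℝ ((ρ n).normed volume) (x - t) w) := by
      intro t
      have h1 : HasFDerivAt ((ρ n).normed volume) (fderiv ℝ ((ρ n).normed volume) (x - t)) (x - t) :=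
        (((ρ n).contDiff_normed (n := 1)).differentiable one_ne_zero _).hasFDerivAt
      have h2 : HasFDerivAt (fun t : ℂ => x - t) (-(ContinuousLinearMap.id ℝ ℂ)) t :=
        (hasFDerivAt_id t).const_sub x
      have h3 : HasFDerivAt φ ((fderiv ℝ ((ρ n).normed volume) (x - t)).comp
        (-(ContinuousLinearMap.id ℝ ℂ))) t := h1.comp t h2
      rw [h3.fderiv]
      simp
    simp only [hd, mul_neg, integral_neg, neg_eq_zero] at h0
    rw [zero_apply, ← h0]
    refine integral_congr_ae (Eventually.of_forall fun t => ?_)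
    simp [ContinuousLinearMap.precompL_apply, mul_comm]
  have hconst : ∀ n, ∀ x ∈ ball a δ, k n x = k n a := by
    intro n x hx
    refine (convex_ball a δ).is_const_of_fderivWithin_eq_zero (𝕜 := ℝ)
      (fun y _ => (hder n y).differentiableAt.differentiableWithinAt) (fun y hy => ?_) hx
      (mem_ball_self hδ)
    rw [fderivWithin_of_isOpen isOpen_ball hy, (hder n y).fderiv, hzero n y hy]
  -- Lebesgue differentiation; `K = 2` is the ratio of the outer to the inner radius of the bumps.
  have hlim : ∀ᵐ x : ℂ, Tendsto (fun n => k n x) atTop (𝓝 (f x)) := by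
    refine ContDiffBump.ae_convolution_tendsto_right_of_locallyIntegrable (K := 2) ?_
      (Eventually.of_forall fun n => ?_) hf.locallyIntegrable
    · change Tendsto (fun n : ℕ => δ / ((n : ℝ) + 2)) atTop (𝓝 0)
      exact tendsto_const_nhds.div_atTop (tendsto_atTop_add_const_right _ _
        tendsto_natCast_atTop_atTop)
    · change δ / ((n : ℝ) + 2) ≤ 2 * (δ / (2 * (n + 2)))
      refine le_of_eq ?_
      field_simp
  obtain ⟨x₀, hx₀, hx₀l⟩ : ∃ x₀ ∈ ball a δ, Tendsto (fun n => k n x₀) atTop (𝓝 (f x₀)) := by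
    by_contra! hcon
    exact (measure_ball_pos volume a hδ).ne' (measure_mono_null hcon (ae_iff.1 hlim))
  refine ⟨f x₀, ?_⟩
  filter_upwards [hlim] with x hx hxb
  refine tendsto_nhds_unique hx (hx₀l.congr fun n => ?_)
  rw [hconst n x hxb, hconst n x₀ hx₀]

lemma integral_half_ofReal_sub_I_mul {u₁ u₂ : ℂ → ℝ} (h₁ : Integrable u₁) (h₂ : Integrable u₂) :
    ∫ z, (1 / 2 : ℂ) * ((u₁ z : ℂ) - Complex.I * (u₂ z : ℂ)) =
      (1 / 2) * (((∫ z, u₁ z : ℝ) : ℂ) - Complex.I * ((∫ z, u₂ z : ℝ) : ℂ)) := by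
  have h2' : Integrable fun z => Complex.I * (u₂ z : ℂ) := h₂.ofReal.const_mul _
  have h1' : Integrable fun z => (u₁ z : ℂ) := h₁.ofReal
  rw [integral_const_mul, integral_sub h1' h2', integral_const_mul, integral_complex_ofReal,
    integral_complex_ofReal]

/-- The defining relation of `DzEqOn`, for real directional derivatives. -/
lemma DzEqOn.integral_mul_fderiv_eq {R r : ℝ} (hrR : r < R) {V : ℂ → EReal} {U : Set ℂ}
    {g : ℂ → ℂ} {H : ℂ → ℝ}
    (hint : LocallyIntegrableOn (fun z => (V z).toReal) (ball 0 r))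
    (hH : ContDiffOn ℝ 1 H (ball 0 R)) (hHg : ∀ z ∈ ball (0 : ℂ) R, dz H z = g z)
    (hUr : U ⊆ ball 0 r) (h : DzEqOn (disk R) V U g) {φ : ℂ → ℝ} (hφ : ContDiff ℝ ∞ φ)
    (hc : HasCompactSupport φ) (hs : tsupport φ ⊆ U) (w : ℂ) :
    ∫ z, (V z).toReal * fderiv ℝ φ z w = ∫ z, H z * fderiv ℝ φ z w := by
  have hsr := hs.trans hUr
  have hrR' : ball (0 : ℂ) r ⊆ ball 0 R := ball_subset_ball hrR.le
  have hsR := hsr.trans hrR'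
  have hφd : ∀ w, Continuous fun z => fderiv ℝ φ z w := fun w =>
    (hφ.continuous_fderiv (by simp)).clm_apply continuous_const
  have hcd : ∀ w, HasCompactSupport fun z => fderiv ℝ φ z w := fun w =>
    hc.of_isClosed_subset (isClosed_tsupport _) (tsupport_fderiv_apply_subset φ w)
  have hsd : ∀ w, tsupport (fun z => fderiv ℝ φ z w) ⊆ tsupport φ :=
    tsupport_fderiv_apply_subset φ
  have iV : ∀ w, Integrable fun z => (V z).toReal * fderiv ℝ φ z w := fun w =>
    integrable_mul_of_tsupport_subset hint (hφd w) (hcd w) ((hsd w).trans hsr)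
  have hHl : LocallyIntegrableOn H (ball 0 R) :=
    hH.continuousOn.locallyIntegrableOn measurableSet_ball
  have iH : ∀ w, Integrable fun z => H z * fderiv ℝ φ z w := fun w =>
    integrable_mul_of_tsupport_subset hHl (hφd w) (hcd w) ((hsd w).trans hsR)
  have hHd : ∀ w, ContinuousOn (fun z => fderiv ℝ H z w) (ball 0 R) := fun w =>
    (hH.continuousOn_fderiv_of_isOpen isOpen_ball le_rfl).clm_apply continuousOn_const
  have iHd : ∀ w, Integrable fun z => fderiv ℝ H z w * φ z := fun w =>
    integrable_mul_of_tsupport_subset ((hHd w).locallyIntegrableOn measurableSet_ball)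
      hφ.continuous hc hsR
  have hparts : ∀ w, ∫ z, H z * fderiv ℝ φ z w = -∫ z, fderiv ℝ H z w * φ z := fun w => by
    refine integral_mul_fderiv_eq_neg_fderiv_mul_of_integrable (iHd w) (iH w)
      (integrable_mul_of_tsupport_subset hHl hφ.continuous hc hsR) ?_ ?_
    · intro x hx
      exact (hH.differentiableOn one_ne_zero).differentiableAt (isOpen_ball.mem_nhds (hsR hx))
    · intro x _
      exact hφ.differentiable (by simp) x
  have key := h ⟨φ, hφ, hc, hsR⟩ hs
  have e1 : ∫ z : ℂ, ((V z).toReal : ℂ) * dz φ z =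
      (1 / 2) * (((∫ z, (V z).toReal * fderiv ℝ φ z 1 : ℝ) : ℂ) -
        Complex.I * ((∫ z, (V z).toReal * fderiv ℝ φ z Complex.I : ℝ) : ℂ)) := by
    rw [← integral_half_ofReal_sub_I_mul (iV 1) (iV Complex.I)]
    congr 1
    ext z
    simp only [dz]
    push_cast
    ring
  have e2 : ∫ z : ℂ, g z * (φ z : ℂ) =
      (1 / 2) * (((∫ z, fderiv ℝ H z 1 * φ z : ℝ) : ℂ) -
        Complex.I * ((∫ z, fderiv ℝ H z Complex.I * φ z : ℝ) : ℂ)) := by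
    rw [← integral_half_ofReal_sub_I_mul (iHd 1) (iHd Complex.I)]
    congr 1
    ext z
    by_cases hz : z ∈ tsupport φ
    · rw [← hHg z (hsR hz)]
      simp only [dz]
      push_cast
      ring
    · simp [image_eq_zero_of_notMem_tsupport hz]
  change -∫ z : ℂ, ((V z).toReal : ℂ) * dz φ z = ∫ z : ℂ, g z * (φ z : ℂ) at key
  rw [e1, e2] at key
  -- Both test function and `V` are real, so the real and imaginary parts separate the derivatives
  -- in the directions `1` and `I`.
  have k1 := congrArg Complex.re key
  have k2 := congrArg Complex.im key
  simp at k1 k2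
  have hw1 : ∫ z, (V z).toReal * fderiv ℝ φ z 1 = ∫ z, H z * fderiv ℝ φ z 1 := by
    rw [hparts]; linarith
  have hw2 : ∫ z, (V z).toReal * fderiv ℝ φ z Complex.I = ∫ z, H z * fderiv ℝ φ z Complex.I := by
    rw [hparts]; linarith
  have hw : ∀ z, fderiv ℝ φ z w = w.re * fderiv ℝ φ z 1 + w.im * fderiv ℝ φ z Complex.I := by
    intro z
    have : w = w.re • (1 : ℂ) + w.im • Complex.I := by simp
    conv_lhs => rw [this]
    rw [map_add, map_smul, map_smul, smul_eq_mul, smul_eq_mul]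
  have hexp : ∀ u : ℂ → ℝ, (∀ w, Integrable fun z => u z * fderiv ℝ φ z w) →
      ∫ z, u z * fderiv ℝ φ z w = w.re * (∫ z, u z * fderiv ℝ φ z 1) +
        w.im * ∫ z, u z * fderiv ℝ φ z Complex.I := by
    intro u hu
    rw [← integral_const_mul, ← integral_const_mul,
      ← integral_add ((hu 1).const_mul _) ((hu Complex.I).const_mul _)]
    congr 1
    ext z
    rw [hw]; ring
  rw [hexp _ iV, hexp _ iH, hw1, hw2]

/-- In an open set where `∂V/∂z = ∂H/∂z`, the function `V - H` is locally constant. -/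
lemma DzEqOn.exists_eq_add_const {R r : ℝ} (hrR : r < R) {V : ℂ → EReal}
    (hV : IsSubharmonic (disk R) V) (hne : ∃ z ∈ ball (0 : ℂ) r, V z ≠ ⊥) {U : Set ℂ}
    (hU : IsOpen U) {g : ℂ → ℂ} {H : ℂ → ℝ}
    (hH : ContDiffOn ℝ 1 H (ball 0 R)) (hHg : ∀ z ∈ ball (0 : ℂ) R, dz H z = g z)
    (h : DzEqOn (disk R) V U g) {a : ℂ} (ha : a ∈ U) (har : a ∈ ball (0 : ℂ) r) :
    ∃ δ > 0, ball a δ ⊆ U ∧ ∃ c : ℝ, ∀ z ∈ ball a δ, V z = ((H z + c : ℝ) : EReal) := by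
  have hint := hV.locallyIntegrableOn hrR hne
  have hrR' : ball (0 : ℂ) r ⊆ ball 0 R := ball_subset_ball hrR.le
  obtain ⟨ε, hε, hεb⟩ := Metric.nhds_basis_closedBall.mem_iff.1
    ((hU.inter isOpen_ball).mem_nhds ⟨ha, har⟩)
  set δ := ε / 2 with hδ
  have hδ0 : 0 < δ := by positivity
  have h2δ : ball a (2 * δ) ⊆ U ∩ ball 0 r :=
    (ball_subset_closedBall.trans (closedBall_subset_closedBall (by linarith))).trans hεb
  have hδU : ball a δ ⊆ U ∩ ball 0 r := (ball_subset_ball (by linarith)).trans h2δ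
  have hdiff : LocallyIntegrableOn (fun z => (V z).toReal - H z) (ball 0 r) :=
    hint.sub ((hH.continuousOn.mono hrR').locallyIntegrableOn measurableSet_ball)
  -- The cut-off makes the function globally integrable, as the mollification argument needs, and
  -- test functions supported in the disk do not see it.
  have hfi : Integrable ((ball a (2 * δ)).indicator fun z => (V z).toReal - H z) := by
    rw [integrable_indicator_iff measurableSet_ball]
    exact (hdiff.integrableOn_compact_subset (hεb.trans inter_subset_right)
      (isCompact_closedBall a ε)).mono_set
        (ball_subset_closedBall.trans (closedBall_subset_closedBall (by linarith)))
  obtain ⟨c, hc⟩ := ae_eq_const_of_integral_fderiv_eq_zero hfi hδ0 (by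
    intro φ hφ hcφ hsφ w
    have hU' : DzEqOn (disk R) V (U ∩ ball 0 r) g := fun φ hφ => h φ (hφ.trans inter_subset_left)
    have h1 := hU'.integral_mul_fderiv_eq hrR hint hH hHg inter_subset_right hφ hcφ
      (hsφ.trans h2δ) w
    have hd : Continuous fun z => fderiv ℝ φ z w :=
      (hφ.continuous_fderiv (by simp)).clm_apply continuous_const
    have hcd : HasCompactSupport fun z => fderiv ℝ φ z w :=
      hcφ.of_isClosed_subset (isClosed_tsupport _) (tsupport_fderiv_apply_subset φ w)
    have hsd : tsupport (fun z => fderiv ℝ φ z w) ⊆ ball 0 r :=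
      (tsupport_fderiv_apply_subset φ w).trans (hsφ.trans (h2δ.trans inter_subset_right))
    rw [← sub_eq_zero, ← integral_sub (integrable_mul_of_tsupport_subset hint hd hcd hsd)
      (integrable_mul_of_tsupport_subset (hH.continuousOn.locallyIntegrableOn measurableSet_ball)
        hd hcd (hsd.trans hrR'))] at h1
    rw [← h1]
    congr 1
    ext z
    by_cases hz : z ∈ ball a (2 * δ)
    · rw [indicator_of_mem hz]; ring
    · have : fderiv ℝ φ z w = 0 := by
        by_contra hcon
        exact hz (hsφ (tsupport_fderiv_apply_subset φ w (subset_tsupport _ hcon)))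
      rw [this]; ring)
  refine ⟨δ, hδ0, hδU.trans inter_subset_left, c, fun z hz => ?_⟩
  refine hV.eq_of_ae_eq hrR isOpen_ball (hδU.trans inter_subset_right) (N := fun z => H z + c)
    ((hH.continuousOn.mono ((hδU.trans inter_subset_right).trans hrR')).add continuousOn_const)
    ?_ hz
  filter_upwards [hc, hV.ae_ne_bot hrR hne] with w hw hwb hwδ
  have h1 := hw hwδ
  rw [indicator_of_mem (ball_subset_ball (by linarith) hwδ)] at h1
  have hwr := (hδU hwδ).2
  rw [← EReal.coe_toReal (hV.lt_top w (hrR' hwr)).ne (hwb hwr), EReal.coe_eq_coe_iff]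
  linarith

/-! ### The strong maximum principle -/

/-- The strong maximum principle. -/
lemma IsBoundedSubMean.eqOn_of_le {Ω : Set ℂ} {G : ℂ → ℝ} (hG : IsBoundedSubMean Ω G) {Q : Set ℂ}
    (hQo : IsOpen Q) (hQc : IsPreconnected Q) (hQΩ : Q ⊆ Ω) {m : ℝ} (hle : ∀ q ∈ Q, G q ≤ m)
    (hex : ∃ q ∈ Q, G q = m) : ∀ q ∈ Q, G q = m := by
  obtain ⟨L, hL⟩ := hG.exists_le
  have hGm := hG.measurable
  have husc : UpperSemicontinuousOn G Q := hG.upperSemicontinuousOn.mono hQΩ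
  set u : Set ℂ := {q | q ∈ Q ∧ G q = m} with hu
  have huo : IsOpen u := by
    refine isOpen_iff_mem_nhds.2 fun q hq => ?_
    obtain ⟨s, hs, hsb⟩ := Metric.nhds_basis_closedBall.mem_iff.1 (hQo.mem_nhds hq.1)
    refine mem_of_superset (ball_mem_nhds q hs) fun w hw => ?_
    have hwQ : w ∈ Q := hsb (ball_subset_closedBall hw)
    refine ⟨hwQ, (hle w hwQ).antisymm ?_⟩
    by_contra! hlt
    obtain ⟨δ, hδ, -, hδm⟩ := exists_ball_lt_of_upperSemicontinuousOn hQo husc hwQ hlt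
    have hint : IntegrableOn (fun v : ℂ => G (q + s • v)) (ball 0 1) := by
      refine Measure.integrableOn_of_bounded (M := L) measure_ball_lt_top.ne
        (Measurable.aestronglyMeasurable (by fun_prop)) (Eventually.of_forall fun v => ?_)
      rw [Real.norm_of_nonneg (hG.nonneg _)]; exact hL _
    have hnn : 0 ≤ᵐ[volume.restrict (ball (0 : ℂ) 1)] fun v => m - G (q + s • v) :=
      (ae_restrict_iff' measurableSet_ball).2 (Eventually.of_forall fun v hv =>
        sub_nonneg.2 (hle _ (hsb (ball_subset_closedBall (add_smul_mem_ball hs hv)))))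
    -- The area mean at a maximum point forces `G = m` almost everywhere in the disk; a point with
    -- `G < m` would have a whole neighbourhood of such points.
    have hzero : ∫ v in ball (0 : ℂ) 1, (m - G (q + s • v)) = 0 := by
      refine le_antisymm ?_ (integral_nonneg_of_ae hnn)
      rw [integral_sub (integrableOn_ball_const _ _ _) hint]
      have := hG.subMean q s hs (hsb.trans hQΩ)
      rw [hq.2] at this
      simp only [integral_const, measureReal_restrict_apply_univ, volume_real_unit_ball,
        smul_eq_mul]
      linarith
    rw [integral_eq_zero_iff_of_nonneg_ae hnn ((integrableOn_ball_const _ _ _).sub hint),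
      EventuallyEq, ae_restrict_iff' measurableSet_ball] at hzero
    have hnull : volume (ball w δ ∩ ball q s) = 0 := by
      rw [← volume_preimage_affine_eq_zero hs.ne' q]
      refine measure_mono_null ?_ (ae_iff.1 hzero)
      rintro v ⟨hv1, hv2⟩ hcon
      have hvb : v ∈ ball (0 : ℂ) 1 := by
        rw [mem_ball_iff_norm, add_sub_cancel_left, norm_smul, Real.norm_of_nonneg hs.le] at hv2
        rw [mem_ball_zero_iff]
        by_contra! h1
        nlinarith
      have h1 := hcon hvb
      have h2 := hδm _ hv1
      simp only [Pi.zero_apply] at h1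
      linarith
    exact ((isOpen_ball.inter isOpen_ball).measure_pos volume ⟨w, mem_ball_self hδ, hw⟩).ne' hnull
  have hsub : Q ⊆ u := by
    refine hQc.subset_of_closure_inter_subset huo ?_ ?_
    · obtain ⟨q, hq, hqm⟩ := hex
      exact ⟨q, hq, hq, hqm⟩
    · rintro q ⟨hqu, hqQ⟩
      refine ⟨hqQ, (hle q hqQ).antisymm ?_⟩
      by_contra! hlt
      obtain ⟨δ, hδ, -, hδm⟩ := exists_ball_lt_of_upperSemicontinuousOn hQo husc hqQ hlt
      obtain ⟨w, hw, hwd⟩ := Metric.mem_closure_iff.1 hqu δ hδ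
      have := hδm w (by rwa [mem_ball, dist_comm])
      exact this.ne hw.2
  exact fun q hq => (hsub hq).2

/-! ### Harmonic primitives, exposed values and cones of dominance -/

/-- A holomorphic function in a disk is the derivative `∂H/∂z` of a harmonic function `H`. -/
lemma exists_harmonic_dz_eq {R : ℝ} {g : ℂ → ℂ} (hg : DifferentiableOn ℂ g (ball 0 R)) :
    ∃ H : ℂ → ℝ, HarmonicOnNhd H (ball 0 R) ∧ (∀ z ∈ ball (0 : ℂ) R, dz H z = g z) ∧ H 0 = 0 ∧
      ∀ z ∈ ball (0 : ℂ) R, ∀ w, fderiv ℝ H z w = 2 * (g z * w).re := by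
  obtain ⟨G, hG0, hG⟩ := hg.isExactOn_ball.with_val_at 0 0
  have hfd : ∀ z ∈ ball (0 : ℂ) R, ∀ w,
      fderiv ℝ (fun z => (2 * G z).re) z w = 2 * (g z * w).re := by
    intro z hz w
    have h1 : HasFDerivAt (fun z => 2 * G z) _ z :=
      (((hG z hz).const_mul 2).hasFDerivAt).restrictScalars ℝ
    have h2 := Complex.reCLM.hasFDerivAt.comp z h1
    have h3 : fderiv ℝ (fun z => (2 * G z).re) z = _ := h2.fderiv
    rw [h3]
    simp
    ring
  refine ⟨fun z => (2 * G z).re, fun z hz => ?_, fun z hz => ?_, by simp [hG0], hfd⟩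
  · have hd : DifferentiableOn ℂ (fun z => 2 * G z) (ball 0 R) := fun w hw =>
      ((hG w hw).const_mul 2).differentiableAt.differentiableWithinAt
    exact (hd.analyticAt (isOpen_ball.mem_nhds hz)).harmonicAt_re
  · rw [dz, hfd z hz, hfd z hz]
    apply Complex.ext <;> simp

/-- An extreme point of the convex hull of a finite set is strictly exposed. -/
lemma exists_forall_re_mul_lt {k : ℕ} {a : Fin k → ℂ} {j : Fin k}
    (hj : a j ∈ (convexHull ℝ (range a)).extremePoints ℝ) :
    ∃ θ : ℂ, ∀ i, a i ≠ a j → (a i * θ).re < (a j * θ).re := by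
  set S : Set ℂ := range a \ {a j} with hS
  -- Removing an extreme point keeps the hull convex, so the hull of the other values omits `a j`
  -- and can be strictly separated from it.
  have hconv : Convex ℝ (convexHull ℝ (range a) \ {a j}) :=
    ((convex_convexHull ℝ _).mem_extremePoints_iff_convex_sdiff.1 hj).2
  have hnot : a j ∉ convexHull ℝ S := fun h =>
    (convexHull_min (sdiff_subset_sdiff_left (subset_convexHull ℝ _)) hconv h).2 rfl
  have hcl : IsClosed (convexHull ℝ S) :=
    (((finite_range a).sdiff).isCompact_convexHull (𝕜 := ℝ)).isClosed
  obtain ⟨f, u, hf1, hf2⟩ := geometric_hahn_banach_closed_point (convex_convexHull ℝ S) hcl hnot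
  have hre : ∀ w : ℂ, (w * ((f 1 : ℂ) - f Complex.I * Complex.I)).re = f w := by
    intro w
    have : w = w.re • (1 : ℂ) + w.im • Complex.I := by simp
    conv_rhs => rw [this]
    rw [map_add, map_smul, map_smul]
    simp
  refine ⟨(f 1 : ℂ) - f Complex.I * Complex.I, fun i hi => ?_⟩
  rw [hre, hre]
  exact (hf1 _ (subset_convexHull ℝ S ⟨⟨i, rfl⟩, hi⟩)).trans hf2

/-- The open convex cone generated by the disk of radius `η` centered at `θ`. -/
def cone (θ : ℂ) (η : ℝ) : Set ℂ := {w | ∃ t : ℝ, 0 < t ∧ ‖w - t • θ‖ < t * η}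

lemma isOpen_cone (θ : ℂ) (η : ℝ) : IsOpen (cone θ η) := by
  have : cone θ η = ⋃ t : ℝ, ⋃ _ : 0 < t, {w | ‖w - t • θ‖ < t * η} := by
    ext w; simp [cone]
  rw [this]
  exact isOpen_iUnion fun t => isOpen_iUnion fun _ => isOpen_lt (by fun_prop) continuous_const

lemma smul_mem_cone {θ w : ℂ} {η s : ℝ} (hs : 0 < s) (hw : w ∈ cone θ η) : s • w ∈ cone θ η := by
  obtain ⟨t, ht, h⟩ := hw
  refine ⟨s * t, mul_pos hs ht, ?_⟩
  rw [mul_smul, ← smul_sub, norm_smul, Real.norm_of_nonneg hs.le, mul_assoc]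
  exact mul_lt_mul_of_pos_left h hs

lemma convex_cone (θ : ℂ) (η : ℝ) : Convex ℝ (cone θ η) := by
  rw [convex_iff_forall_pos]
  rintro x ⟨t, ht, hx⟩ y ⟨s, hs, hy⟩ a b ha hb -
  refine ⟨a * t + b * s, by positivity, ?_⟩
  have : a • x + b • y - (a * t + b * s) • θ = a • (x - t • θ) + b • (y - s • θ) := by
    module
  rw [this]
  calc _ ≤ ‖a • (x - t • θ)‖ + ‖b • (y - s • θ)‖ := norm_add_le _ _
    _ = a * ‖x - t • θ‖ + b * ‖y - s • θ‖ := by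
      rw [norm_smul, norm_smul, Real.norm_of_nonneg ha.le, Real.norm_of_nonneg hb.le]
    _ < a * (t * η) + b * (s * η) := add_lt_add (mul_lt_mul_of_pos_left hx ha)
      (mul_lt_mul_of_pos_left hy hb)
    _ = _ := by ring

/-- The strict inequalities at `(0, θ)` persist nearby by continuity, and homogeneity in `w` extends
them from a disk around `θ` to the cone. Indices with the same value at `0` give the same function,
hence equality. -/
lemma exists_cone_re_mul_le {k : ℕ} {R : ℝ} (hR : 0 < R) {g : Fin k → ℂ → ℂ}
    (hg : ∀ i, DifferentiableOn ℂ (g i) (ball 0 R))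
    (hdistinct : ∀ i j, g i 0 = g j 0 → EqOn (g i) (g j) (ball 0 R)) {j : Fin k}
    (hj : g j 0 ∈ (convexHull ℝ (range fun j => g j 0)).extremePoints ℝ) :
    ∃ θ : ℂ, ∃ η > 0, ∃ ρ > 0, ∀ z ∈ ball (0 : ℂ) ρ, ∀ w ∈ cone θ η, ∀ i,
      (g i z * w).re ≤ (g j z * w).re := by
  obtain ⟨θ, hθ⟩ := exists_forall_re_mul_lt (a := fun j => g j 0) hj
  have hc : ∀ i, ContinuousAt (fun p : ℂ × ℂ => (g i p.1 * p.2).re) (0, θ) := fun i => by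
    have h1 : ContinuousAt (g i) 0 :=
      (hg i).continuousOn.continuousAt (ball_mem_nhds 0 hR)
    have h2 : ContinuousAt (fun p : ℂ × ℂ => g i p.1) (0, θ) :=
      ContinuousAt.comp (f := Prod.fst) (x := ((0 : ℂ), θ)) h1 continuousAt_fst
    exact Complex.continuous_re.continuousAt.comp (h2.mul continuousAt_snd)
  have hev : ∀ᶠ p : ℂ × ℂ in 𝓝 (0, θ), ∀ i, (g i p.1 * p.2).re ≤ (g j p.1 * p.2).re := by
    rw [eventually_all]
    intro i
    by_cases hij : g i 0 = g j 0
    · have : ∀ᶠ p : ℂ × ℂ in 𝓝 (0, θ), p.1 ∈ ball (0 : ℂ) R :=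
        continuousAt_fst.eventually (ball_mem_nhds 0 hR)
      filter_upwards [this] with p hp
      rw [hdistinct i j hij hp]
    · filter_upwards [(hc i).eventually_lt (hc j) (hθ i hij)] with p hp using hp.le
  obtain ⟨ε, hε, hb⟩ := Metric.eventually_nhds_iff_ball.1 hev
  refine ⟨θ, ε, hε, ε, hε, fun z hz w hw i => ?_⟩
  obtain ⟨t, ht, hwt⟩ := hw
  have h1 : t⁻¹ • w ∈ ball θ ε := by
    rw [mem_ball_iff_norm]
    have : t⁻¹ • w - θ = t⁻¹ • (w - t • θ) := by rw [smul_sub, inv_smul_smul₀ ht.ne']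
    rw [this, norm_smul, Real.norm_of_nonneg (by positivity), inv_mul_lt_iff₀ ht]
    exact hwt
  have h2 := hb (z, t⁻¹ • w) (by
    rw [← ball_prod_same]; exact ⟨hz, h1⟩) i
  simp only [mul_smul_comm, Complex.smul_re, smul_eq_mul] at h2
  exact le_of_mul_le_mul_left h2 (by positivity)

/-! ### Monotonicity and constancy of `V - H j` near the origin -/

section LocalStructure

variable {R r : ℝ} {V : ℂ → EReal} {k : ℕ} {g : Fin k → ℂ → ℂ} {H : Fin k → ℂ → ℝ}

lemma disk_sdiff_suppLaplacian :
    ((disk R : Set ℂ) \ suppLaplacian (disk R) V) =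
      ball 0 R \ Distribution.dsupport (distLaplacian (disk R) V) := by
  rw [suppLaplacian, sdiff_self_inter]
  rfl

lemma isOpen_component (z : ℂ) : IsOpen (component (disk R) V z) := by
  refine IsOpen.connectedComponentIn ?_
  rw [disk_sdiff_suppLaplacian]
  exact isOpen_ball.sdiff Distribution.isClosed_dsupport

/-- Near a point of the region where `∂V/∂z = g i`, the function `V - H i` is constant. -/
lemma IsSubharmonic.exists_eq_add_const_of_mem_region (hV : IsSubharmonic (disk R) V) (hrR : r < R)
    (hne : ∃ z ∈ ball (0 : ℂ) r, V z ≠ ⊥)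
    (hH : ∀ i, HarmonicOnNhd (H i) (ball 0 R))
    (hHg : ∀ i, ∀ z ∈ ball (0 : ℂ) R, dz (H i) z = g i z) {i : Fin k} {z : ℂ}
    (hz : z ∈ region (disk R) V (g i)) (hzr : z ∈ ball (0 : ℂ) r) :
    ∃ δ > 0, ∃ c : ℝ, ∀ w ∈ ball z δ, V w = ((H i w + c : ℝ) : EReal) := by
  obtain ⟨δ, hδ, -, c, hc⟩ := DzEqOn.exists_eq_add_const hrR hV hne (isOpen_component z)
    ((hH i).contDiffOn.of_le one_le_two) (hHg i) hz.2 (mem_connectedComponentIn hz.1) hzr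
  exact ⟨δ, hδ, c, hc⟩

/-- Outside the support of `ΔV`, the function `V - H j` is nonincreasing in the directions in which
the slope of `H j` is the largest one. -/
lemma IsSubharmonic.le_add_of_segment_subset (hV : IsSubharmonic (disk R) V) (hrR : r < R)
    (hne : ∃ z ∈ ball (0 : ℂ) r, V z ≠ ⊥) (hg : IsPiecewiseHolomorphic (disk R) V g)
    (hH : ∀ i, HarmonicOnNhd (H i) (ball 0 R))
    (hHg : ∀ i, ∀ z ∈ ball (0 : ℂ) R, dz (H i) z = g i z)
    (hHd : ∀ i, ∀ z ∈ ball (0 : ℂ) R, ∀ w, fderiv ℝ (H i) z w = 2 * (g i z * w).re)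
    {j : Fin k} {z v : ℂ}
    (hseg : segment ℝ z (z + v) ⊆
      ball 0 r \ Distribution.dsupport (distLaplacian (disk R) V))
    (hle : ∀ w ∈ segment ℝ z (z + v), ∀ i, (g i w * v).re ≤ (g j w * v).re) {m : ℝ}
    (hm : V z ≤ ((H j z + m : ℝ) : EReal)) : V (z + v) ≤ ((H j (z + v) + m : ℝ) : EReal) := by
  have hrR' : ball (0 : ℂ) r ⊆ ball 0 R := ball_subset_ball hrR.le
  have hmem : ∀ s ∈ Icc (0 : ℝ) 1, z + s • v ∈ segment ℝ z (z + v) := by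
    intro s hs
    rw [segment_eq_image']
    exact ⟨s, hs, by simp⟩
  have hloc : ∀ s ∈ Icc (0 : ℝ) 1, ∃ i, ∃ δ > 0, ∃ c : ℝ, ∀ w ∈ ball (z + s • v) δ,
      V w = ((H i w + c : ℝ) : EReal) := by
    intro s hs
    have h1 := hseg (hmem s hs)
    have h2 : z + s • v ∈ (disk R : Set ℂ) \ suppLaplacian (disk R) V := by
      rw [disk_sdiff_suppLaplacian]; exact ⟨hrR' h1.1, h1.2⟩
    obtain ⟨i, hi⟩ := hg.exists_dzEqOn _ h2
    exact ⟨i, hV.exists_eq_add_const_of_mem_region hrR hne hH hHg ⟨h2, hi⟩ h1.1⟩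
  set γ : ℝ → ℝ := fun s => (V (z + s • v)).toReal - H j (z + s • v) with hγ
  have hderiv : ∀ s ∈ Icc (0 : ℝ) 1, ∃ d ≤ 0, HasDerivAt γ d s := by
    intro s hs
    obtain ⟨i, δ, hδ, c, hc⟩ := hloc s hs
    have hR := hrR' (hseg (hmem s hs)).1
    -- Locally `V = H i + c`, so the derivative of `γ` is `2 * Re ((g i - g j) * v) ≤ 0`.
    have hline : HasDerivAt (fun s : ℝ => z + s • v) v s := by
      simpa using ((hasDerivAt_id s).smul_const v).const_add z
    have hHi : ∀ i, HasDerivAt (fun s : ℝ => H i (z + s • v)) (2 * (g i (z + s • v) * v).re) s := by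
      intro i
      rw [← hHd i _ hR]
      exact ((hH i _ hR).1.differentiableAt two_ne_zero).hasFDerivAt.comp_hasDerivAt s hline
    refine ⟨_, ?_, (((hHi i).add_const c).sub (hHi j)).congr_of_eventuallyEq ?_⟩
    · linarith [hle _ (hmem s hs) i]
    · have : ∀ᶠ s' in 𝓝 s, z + s' • v ∈ ball (z + s • v) δ :=
        hline.continuousAt.eventually (ball_mem_nhds _ hδ)
      filter_upwards [this] with s' hs'
      simp only [hγ, Pi.sub_apply, hc _ hs', EReal.toReal_coe]
  have hanti : AntitoneOn γ (Icc 0 1) := by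
    refine antitoneOn_of_deriv_nonpos (convex_Icc 0 1) (fun s hs => ?_) (fun s hs => ?_)
      fun s hs => ?_
    · obtain ⟨d, -, hd⟩ := hderiv s hs
      exact hd.continuousAt.continuousWithinAt
    · obtain ⟨d, -, hd⟩ := hderiv s (interior_subset hs)
      exact hd.differentiableAt.differentiableWithinAt
    · obtain ⟨d, hd0, hd⟩ := hderiv s (interior_subset hs)
      rw [hd.deriv]; exact hd0
  have h01 := hanti (left_mem_Icc.2 zero_le_one) (right_mem_Icc.2 zero_le_one) zero_le_one
  have hreal : ∀ s ∈ Icc (0 : ℝ) 1, ((V (z + s • v)).toReal : EReal) = V (z + s • v) := by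
    intro s hs
    obtain ⟨i, δ, hδ, c, hc⟩ := hloc s hs
    rw [hc _ (mem_ball_self hδ), EReal.toReal_coe]
  have e0 := hreal 0 (left_mem_Icc.2 zero_le_one)
  have e1 := hreal 1 (right_mem_Icc.2 zero_le_one)
  simp only [hγ, zero_smul, add_zero, one_smul] at h01 e0 e1
  rw [← e0, EReal.coe_le_coe_iff] at hm
  rw [← e1, EReal.coe_le_coe_iff]
  linarith

/-- Near the origin, `V - H j` is bounded below by a constant, which is its value in all of the
region where `∂V/∂z = g j`. -/
lemma IsSubharmonic.exists_local_bound (hV : IsSubharmonic (disk R) V) (hrR : r < R)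
    (hvol : volume (suppLaplacian (disk R) V) = 0)
    (hne : ∃ z ∈ ball (0 : ℂ) r, V z ≠ ⊥) (hr : 0 < r) (hg : IsPiecewiseHolomorphic (disk R) V g)
    (hH : ∀ i, HarmonicOnNhd (H i) (ball 0 R))
    (hHg : ∀ i, ∀ z ∈ ball (0 : ℂ) R, dz (H i) z = g i z)
    (hHd : ∀ i, ∀ z ∈ ball (0 : ℂ) R, ∀ w, fderiv ℝ (H i) z w = 2 * (g i z * w).re)
    (hdistinct : ∀ i j, g i 0 = g j 0 → EqOn (g i) (g j) (ball 0 R)) {j : Fin k}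
    (hj : g j 0 ∈ (convexHull ℝ (range fun j => g j 0)).extremePoints ℝ)
    (hclosure : (0 : ℂ) ∈ closure (region (disk R) V (g j))) :
    ∃ ε > 0, ∃ c : ℝ, ∀ z ∈ ball (0 : ℂ) ε, ((H j z + c : ℝ) : EReal) ≤ V z ∧
      (z ∈ region (disk R) V (g j) → V z = ((H j z + c : ℝ) : EReal)) := by
  obtain ⟨θ, η, hη, ρ₀, hρ₀, hcone⟩ := exists_cone_re_mul_le (hr.trans hrR) hg.holomorphic
    hdistinct hj
  set ρ := min r ρ₀ with hρ
  have hρ0 : 0 < ρ := lt_min hr hρ₀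
  have hρr : ball (0 : ℂ) ρ ⊆ ball 0 r := ball_subset_ball (min_le_left _ _)
  have hρR : ρ < R := (min_le_left _ _).trans_lt hrR
  have hρR' : ball (0 : ℂ) ρ ⊆ ball 0 R := ball_subset_ball hρR.le
  set K := Distribution.dsupport (distLaplacian (disk R) V) with hK
  have hK0 : volume (ball (0 : ℂ) ρ ∩ K) = 0 :=
    measure_mono_null (inter_subset_inter_left _ hρR') hvol
  have hsum : ∀ z ∈ ball (0 : ℂ) (ρ / 4), ∀ v : ℂ, ‖v‖ < ρ / 4 → z + v ∈ ball (0 : ℂ) ρ := by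
    intro z hz v hv
    rw [mem_ball_zero_iff] at hz ⊢
    linarith [norm_add_le z v]
  have hlt : ∀ z ∈ ball (0 : ℂ) ρ, V z < ⊤ := fun z hz => hV.lt_top z (hρR' hz)
  -- monotonicity in the directions of the cone
  have hmono : ∀ z ∈ ball (0 : ℂ) (ρ / 4), ∀ v ∈ cone θ η, ‖v‖ < ρ / 4 → ∀ m : ℝ,
      V z ≤ ((H j z + m : ℝ) : EReal) → V (z + v) ≤ ((H j (z + v) + m : ℝ) : EReal) := by
    intro z hz v hv hvρ m hm
    -- Since `V z` may be `-∞`, monotonicity is expressed through all real upper bounds `m`, and the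
    -- truncation is taken at the level `m` itself.
    have hF := hV.isBoundedSubMean (r := ρ) hρR (hH j) m
    have hzρ : z ∈ ball (0 : ℂ) ρ := ball_subset_ball (by linarith) hz
    have hzv := hsum z hz v hvρ
    have h1 := hF.add_le hρ0 Distribution.isClosed_dsupport hK0 (isOpen_cone θ η)
      (fun t ht v hv => smul_mem_cone ht hv) (fun z v hv hseg => ?_) hz hv hvρ
    · rw [indicator_of_mem hzv, indicator_of_mem hzρ] at h1
      have h2 := (trunc_le_iff (M := m) (hlt z hzρ)).2 ⟨hm, le_rfl⟩
      exact ((trunc_le_iff (hlt _ hzv)).1 (by linarith : trunc V (H j) m (z + v) ≤ m)).1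
    · have hz1 := (hseg (left_mem_segment ℝ z (z + v))).1
      have hz2 := (hseg (right_mem_segment ℝ z (z + v))).1
      rw [indicator_of_mem hz1, indicator_of_mem hz2]
      refine add_le_add ((trunc_le_iff (hlt _ hz2)).2 ⟨?_, le_trunc (hlt z hz1)⟩) le_rfl
      exact hV.le_add_of_segment_subset hrR hne hg hH hHg hHd
        (hseg.trans (sdiff_subset_sdiff_left hρr))
        (fun w hw i => hcone w (ball_subset_ball (min_le_right _ _) (hseg hw).1) v hv i)
        ((trunc_le_iff (hlt z hz1)).1 le_rfl).1
  -- constancy on translated cones, by the maximum principle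
  have hconst : ∀ z ∈ ball (0 : ℂ) (ρ / 4), z ∈ region (disk R) V (g j) →
      ∃ c : ℝ, V z = ((H j z + c : ℝ) : EReal) ∧ ∀ v ∈ cone θ η, ‖v‖ < ρ / 4 →
        V (z + v) = ((H j (z + v) + c : ℝ) : EReal) := by
    intro z hz hzreg
    have hzρ : z ∈ ball (0 : ℂ) ρ := ball_subset_ball (by linarith) hz
    obtain ⟨δ, hδ, c, hc⟩ := hV.exists_eq_add_const_of_mem_region hrR hne hH hHg hzreg (hρr hzρ)
    refine ⟨c, hc z (mem_ball_self hδ), fun v hv hvρ => ?_⟩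
    set Q : Set ℂ := (fun x => -z + x) ⁻¹' (cone θ η ∩ ball 0 (ρ / 4)) with hQ
    have hQmem : ∀ v ∈ cone θ η, ‖v‖ < ρ / 4 → z + v ∈ Q := fun v hv hvρ => by
      rw [hQ, mem_preimage, neg_add_cancel_left]; exact ⟨hv, mem_ball_zero_iff.2 hvρ⟩
    have hQρ : Q ⊆ ball 0 ρ := fun q hq => by
      have := hsum z hz (-z + q) (mem_ball_zero_iff.1 hq.2)
      rwa [add_neg_cancel_left] at this
    have hQle : ∀ q ∈ Q, V q ≤ ((H j q + c : ℝ) : EReal) := fun q hq => by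
      have := hmono z hz (-z + q) hq.1 (mem_ball_zero_iff.1 hq.2) c (hc z (mem_ball_self hδ)).le
      rwa [add_neg_cancel_left] at this
    -- The level `c - 1` leaves the value `c` of `V - H j` untouched; after the shift the maximum is
    -- `1`.
    have hF := hV.isBoundedSubMean (r := ρ) hρR (hH j) (c - 1)
    have hFQ : ∀ q ∈ Q, (ball (0 : ℂ) ρ).indicator
        (fun z => trunc V (H j) (c - 1) z + -(c - 1)) q = 1 := by
      refine hF.eqOn_of_le (((isOpen_cone θ η).inter isOpen_ball).preimage (by fun_prop))
        (((convex_cone θ η).inter (convex_ball 0 _)).translate_preimage_right (-z)).isPreconnected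
        hQρ (fun q hq => ?_) ?_
      · rw [indicator_of_mem (hQρ hq)]
        have := (trunc_le_iff (M := c - 1) (m := c) (hlt q (hQρ hq))).2 ⟨hQle q hq, by linarith⟩
        linarith
      -- The maximum is attained at `z + t • θ`, with `t` small enough to stay where `V = H j + c`.
      · set t := min δ (ρ / 4) / (2 * (‖θ‖ + 1)) with ht
        have hmin : 0 < min δ (ρ / 4) := lt_min hδ (by positivity)
        have ht0 : 0 < t := by positivity
        have htθ : ‖t • θ‖ < min δ (ρ / 4) := by
          rw [norm_smul, Real.norm_of_nonneg ht0.le, ht, div_mul_eq_mul_div, div_lt_iff₀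
            (by positivity)]
          nlinarith [norm_nonneg θ]
        have hcmem : t • θ ∈ cone θ η := ⟨t, ht0, by simpa using mul_pos ht0 hη⟩
        have hqQ := hQmem _ hcmem (htθ.trans_le (min_le_right _ _))
        refine ⟨z + t • θ, hqQ, ?_⟩
        rw [indicator_of_mem (hQρ hqQ), trunc, hc (z + t • θ) (by
          rw [mem_ball_iff_norm, add_sub_cancel_left]; exact htθ.trans_le (min_le_left _ _)),
          max_eq_left (EReal.coe_le_coe_iff.2 (by linarith)), EReal.toReal_coe]
        ring
    have hq := hQmem v hv hvρ
    have h1 := hFQ _ hq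
    rw [indicator_of_mem (hQρ hq)] at h1
    refine (hQle _ hq).antisymm ?_
    by_contra! hcon
    have h2 := (trunc_lt_iff (M := c - 1) (m := c) (hlt _ (hQρ hq))).2 ⟨hcon, by linarith⟩
    linarith
  -- a common point of the translated cones
  set t := ρ / 8 / (‖θ‖ + 1) with ht
  have ht0 : 0 < t := by positivity
  have htθ : ‖t • θ‖ < ρ / 8 := by
    rw [norm_smul, Real.norm_of_nonneg ht0.le, ht, div_mul_eq_mul_div, div_lt_iff₀ (by positivity)]
    nlinarith [norm_nonneg θ]
  set p := t • θ with hp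
  -- For `‖z‖ < t * η` the point `p = t • θ` satisfies `‖(p - z) - t • θ‖ = ‖z‖ < t * η`, so `p`
  -- lies in the cone with vertex `z`.
  set ε := min (t * η) (ρ / 8) with hε
  have hε0 : 0 < ε := lt_min (mul_pos ht0 hη) (by positivity)
  have hpz : ∀ z ∈ ball (0 : ℂ) ε, z ∈ ball (0 : ℂ) (ρ / 4) ∧ p - z ∈ cone θ η ∧
      ‖p - z‖ < ρ / 4 := by
    intro z hz
    rw [mem_ball_zero_iff] at hz
    have h1 := hz.trans_le (min_le_left _ _)
    have h2 := hz.trans_le (min_le_right _ _)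
    refine ⟨mem_ball_zero_iff.2 (by linarith), ⟨t, ht0, ?_⟩, ?_⟩
    · rw [sub_right_comm, sub_self, zero_sub, norm_neg]; exact h1
    · linarith [norm_sub_le p z]
  obtain ⟨z₀, hz₀reg, hz₀⟩ := Metric.mem_closure_iff.1 hclosure ε hε0
  rw [dist_comm] at hz₀
  obtain ⟨h1, h2, h3⟩ := hpz z₀ hz₀
  obtain ⟨c, -, hc⟩ := hconst z₀ h1 hz₀reg
  have hVp := hc _ h2 h3
  rw [add_sub_cancel] at hVp
  refine ⟨ε, hε0, c, fun z hz => ⟨?_, fun hzreg => ?_⟩⟩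
  · obtain ⟨k1, k2, k3⟩ := hpz z hz
    -- A real bound `q` strictly between `V z` and `H j z + c` would be carried by monotonicity to
    -- `p`, where `V - H j` is exactly `c`.
    by_contra! hcon
    obtain ⟨q, hq1, hq2⟩ := EReal.lt_iff_exists_real_btwn.1 hcon
    rw [EReal.coe_lt_coe_iff] at hq2
    have := hmono z k1 _ k2 k3 (q - H j z) (by rw [add_sub_cancel]; exact hq1.le)
    rw [add_sub_cancel, hVp, EReal.coe_le_coe_iff] at this
    linarith
  · obtain ⟨k1, k2, k3⟩ := hpz z hz
    obtain ⟨c', hc1, hc2⟩ := hconst z k1 hzreg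
    have := hc2 _ k2 k3
    rw [add_sub_cancel, hVp, EReal.coe_eq_coe_iff] at this
    rw [hc1, EReal.coe_eq_coe_iff]
    linarith

end LocalStructure

end PiecewiseHarmonic

/-! ### Gluing the local bounds -/

open MeasureTheory Metric Set Filter PiecewiseHarmonic in
theorem mainTheorem4 (R : ℝ) (hR : 0 < R) (V : ℂ → EReal)
    (hV : PiecewiseHarmonic.IsSH₀ (PiecewiseHarmonic.disk R) V)
    (k : ℕ) (g : Fin k → ℂ → ℂ)
    (hg : PiecewiseHarmonic.IsPiecewiseHolomorphic (PiecewiseHarmonic.disk R) V g)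
    (hclosure : ∀ i, (0 : ℂ) ∈
      closure (PiecewiseHarmonic.region (PiecewiseHarmonic.disk R) V (g i)))
    (hdistinct : ∀ i j, g i 0 = g j 0 → Set.EqOn (g i) (g j) (Metric.ball 0 R))
    (hextreme : ∀ i, g i 0 ∈
      (convexHull ℝ (Set.range fun j => g j 0)).extremePoints ℝ) :
    ∃ H : Fin k → ℂ → ℝ,
      (∀ i, InnerProductSpace.HarmonicOnNhd (H i) (Metric.ball 0 R) ∧
        (∀ z ∈ Metric.ball (0 : ℂ) R, PiecewiseHarmonic.dz (H i) z = g i z) ∧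
        H i 0 = 0) ∧
      ∃ c : ℝ, ∀ᶠ z in 𝓝 (0 : ℂ), V z = (((⨆ i, H i z) + c : ℝ) : EReal) := by
  have hsub := hV.isSubharmonic
  choose H hH hHg hH0 hHd using fun i => exists_harmonic_dz_eq (hg.holomorphic i)
  refine ⟨H, fun i => ⟨hH i, hHg i, hH0 i⟩, ?_⟩
  -- a smaller disk on which `V` is not identically `-∞`
  obtain ⟨a, haR, ha⟩ := hsub.exists_ne_bot
  have haR' : ‖a‖ < R := mem_ball_zero_iff.1 haR
  obtain ⟨r, hr1, hrR⟩ := exists_between haR'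
  have hr : 0 < r := (norm_nonneg a).trans_lt hr1
  have hne : ∃ z ∈ ball (0 : ℂ) r, V z ≠ ⊥ := ⟨a, mem_ball_zero_iff.2 hr1, ha⟩
  have hae : ∀ᵐ z : ℂ, z ∈ ball (0 : ℂ) R → ∃ i, z ∈ region (disk R) V (g i) := by
    filter_upwards [measure_eq_zero_iff_ae_notMem.1 hV.volume_suppLaplacian] with z hz hzR
    obtain ⟨i, hi⟩ := hg.exists_dzEqOn z ⟨hzR, hz⟩
    exact ⟨i, ⟨hzR, hz⟩, hi⟩
  -- For `k = 0` every point of the disk would lie in the null set `K`.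
  have hk : Nonempty (Fin k) := by
    by_contra hcon
    rw [not_nonempty_iff] at hcon
    refine (measure_ball_pos volume (0 : ℂ) hR).ne' (measure_mono_null ?_ (ae_iff.1 hae))
    intro z hz h
    exact (h hz).elim fun i _ => hcon.elim i
  choose ε hε c hc using fun j => hsub.exists_local_bound hrR hV.volume_suppLaplacian hne hr hg hH
    hHg hHd hdistinct (hextreme j) (hclosure j)
  obtain ⟨ε₀, hε₀, hε₀r, hε₀j⟩ : ∃ ε₀ > 0, ε₀ ≤ r ∧ ∀ j, ε₀ ≤ ε j :=
    ⟨min r (⨅ j, ε j), lt_min hr (by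
      obtain ⟨j, hj⟩ := exists_eq_ciInf_of_finite (f := ε)
      rw [← hj]; exact hε j), min_le_left _ _,
      fun j => (min_le_right _ _).trans (ciInf_le (finite_range ε).bddBelow j)⟩
  have hbR : ball (0 : ℂ) ε₀ ⊆ ball 0 R := ball_subset_ball (hε₀r.trans hrR.le)
  set N : ℂ → ℝ := fun z => ⨆ j, (H j z + c j) with hN
  have hNle : ∀ z j, H j z + c j ≤ N z := fun z j =>
    le_ciSup (f := fun j => H j z + c j) (finite_range _).bddAbove j
  have hHc : ∀ j, ContinuousOn (fun z => H j z + c j) (ball (0 : ℂ) ε₀) := fun j =>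
    ((hH j).contDiffOn.continuousOn.mono hbR).add continuousOn_const
  have hNc : ContinuousOn N (ball (0 : ℂ) ε₀) := by
    have : N = fun z => Finset.univ.sup' Finset.univ_nonempty fun j => H j z + c j := by
      ext z; rw [hN, Finset.sup'_univ_eq_ciSup]
    rw [this]
    exact ContinuousOn.finset_sup'_apply _ fun j _ => hHc j
  have hNV : ∀ z ∈ ball (0 : ℂ) ε₀, (N z : EReal) ≤ V z := by
    intro z hz
    obtain ⟨j, hj⟩ := exists_eq_ciSup_of_finite (f := fun j => H j z + c j)
    change ((⨆ j, (H j z + c j) : ℝ) : EReal) ≤ V z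
    rw [← hj]
    exact (hc j z (ball_subset_ball (hε₀j j) hz)).1
  -- In the region of index `i` one has `V = H i + c i ≤ N ≤ V`, and the regions cover almost all of
  -- the disk.
  have hVN : ∀ z ∈ ball (0 : ℂ) ε₀, V z = N z := by
    intro z hz
    refine hsub.eq_of_ae_eq hrR isOpen_ball (ball_subset_ball hε₀r) hNc ?_ hz
    filter_upwards [hae] with w hw hwε
    obtain ⟨i, hi⟩ := hw (hbR hwε)
    refine le_antisymm ?_ (hNV w hwε)
    rw [(hc i w (ball_subset_ball (hε₀j i) hwε)).2 hi, EReal.coe_le_coe_iff]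
    exact hNle w i
  -- all the constants are equal to the value of `V` at the origin
  have h0 : (0 : ℂ) ∈ ball (0 : ℂ) ε₀ := mem_ball_self hε₀
  have hceq : ∀ j, c j = N 0 := by
    intro j
    by_contra hcon
    -- A discrepancy at `0` would persist nearby by continuity, but `H j + c j = V = N` at points of
    -- the region of index `j` arbitrarily close to `0`.
    have h1 : ∀ᶠ z in 𝓝 (0 : ℂ), H j z + c j ≠ N z := by
      have hca := (hHc j).continuousAt (isOpen_ball.mem_nhds h0)
      have hcN := hNc.continuousAt (isOpen_ball.mem_nhds h0)
      refine hca.ne_iff_eventually_ne hcN |>.1 ?_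
      rw [hH0, zero_add]; exact hcon
    obtain ⟨z, ⟨hz1, hz2⟩, hz3⟩ :=
      mem_closure_iff_nhds.1 (hclosure j) _ (inter_mem h1 (isOpen_ball.mem_nhds h0))
    refine hz1 ?_
    have h2 := (hc j z (ball_subset_ball (hε₀j j) hz2)).2 hz3
    rw [hVN z hz2, EReal.coe_eq_coe_iff] at h2
    exact h2.symm
  refine ⟨N 0, ?_⟩
  filter_upwards [isOpen_ball.mem_nhds h0] with z hz
  rw [hVN z hz, EReal.coe_eq_coe_iff, ciSup_add (finite_range _).bddAbove]
  exact congrArg iSup (funext fun j => congrArg (H j z + ·) (hceq j))
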